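/- **Setting.** Equip $\mathbb R^d$ with the metric of the max norm, and for $\mathbf r\in\mathbb Q^d$ let $H(\mathbf r)=q$, where $\mathbf r=\mathbf p/q$ is in reduced form ($\mathbf p\in\mathbb Z^d$, $q\ge 1$, $\gcd(p_1,\dots,p_d,q)=1$). Let $1\le k\le d$. Write $[n,m]=\binom{n+m}{m}$, let $n_{k,d}$ be the largest integer $n\geq 0$ with $\sum_{j=1}^{n}[k-1,j]\le d$, put $m_{k,d}=d-\sum_{j=1}^{n_{k,d}}[k-1,j]$ and $$N_{k,d}=\sum_{j=1}^{n_{k,d}} j\,[k-1,j]+(n_{k,d}+1)\,m_{k,d},\qquad c(k,d)=\frac{d+1}{N_{k,d}}.$$ For $c>0$ let $\psi_c(t)=t^{-c}$. Let $M\subset\mathbb R^d$ be a $k$-dimensional smooth (that is, $C^\infty$) embedded submanifold. Call $M$ *nondegenerate* if there are a smooth local parametrization $\Psi:U\to M$ ($U\subset\mathbb R^k$ open), a point $\mathbf v\in U$ and an integer $D\ge1$ such that the partial derivatives $\partial^\alpha\Psi(\mathbf v)$, $0<|\alpha|\le D$, span $\mathbb R^d$. For $\psi:(0,\infty)\to(0,\infty)$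 let $$\mathrm{BA}_M(\psi)=\big\{\mathbf x\in M:\ \exists\,\varepsilon>0\ \ \forall\,\mathbf r\in\mathbb Q^d\cap M\quad \|\mathbf x-\mathbf r\|\ge\varepsilon\,\psi(H(\mathbf r))\big\}.$$ Call $\psi$ a *Dirichlet function for intrinsic approximation on $M$* if for every $\mathbf x\in M$ there are a constant $C_{\mathbf x}$ and a sequence $\mathbf r_n\in\mathbb Q^d\cap M$ with $\mathbf r_n\to\mathbf x$ and $\|\mathbf x-\mathbf r_n\|\le C_{\mathbf x}\,\psi(H(\mathbf r_n))$ for all $n$. Let the *intrinsic Dirichlet exponent* $\delta_M^{\rm int}\in[0,\infty]$ be the supremum of all $c>0$ such that $\psi_c$ is a Dirichlet function for intrinsic approximation on $M$ (with $\sup\emptyset=0$). **Theorem.** Let $M\subset\mathbb R^d$ be a nondegenerate submanifold of dimension $k$, where $1\le k\le d$. Then the Hausdorff dimension of $\mathrm{BA}_M(\psi_{c(k,d)})$ is equal to $k$: $$\dim\big(\mathrm{BA}_M(\psi_{c(k,d)})\big)=k .$$ Consequently, no Dirichlet function for intrinsic approximation on $M$ decays faster than $\psi_{c(k,d)}$,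 that is, there is no such Dirichlet function $\varphi$ with $\varphi(t)/\psi_{c(k,d)}(t)\to0$ as $t\to\infty$; and $\delta_M^{\rm int}\le c(k,d)$. -/

import Mathlib

open Set Filter Topology
open scoped ContDiff ENNReal

namespace IntrinsicApprox

/-! ### Diophantine triples

`M` and `Q` are subsets of a metric space `X` (the points to be approximated and the
approximants), and `H` is the height; only the values of `H` on `Q` matter. -/

section Triples

/-- `ψ : (0,∞) → (0,∞)` is a Dirichlet function for the triple `(M, Q, H)`: every `x ∈ M` is the
limit of a sequence `r n ∈ Q` with `dist x (r n) ≤ C_x * ψ (H (r n))` for all `n`.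
Only the restriction of `ψ` to `(0,∞)` is relevant, and it has to be positive there. -/
def IsDirichletFunction {X : Type*} [MetricSpace X] (M Q : Set X) (H : X → ℝ) (ψ : ℝ → ℝ) : Prop :=
  (∀ t : ℝ, 0 < t → 0 < ψ t) ∧
    ∀ x ∈ M, ∃ C : ℝ, ∃ r : ℕ → X,
      (∀ n, r n ∈ Q) ∧ Tendsto r atTop (𝓝 x) ∧ ∀ n, dist x (r n) ≤ C * ψ (H (r n))

/-- The set of `ψ`-badly approximable points of the triple `(M, Q, H)`. -/
def BadlyApproximable {X : Type*} [MetricSpace X] (M Q : Set X) (H : X → ℝ) (ψ : ℝ → ℝ) : Set X :=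
  {x | x ∈ M ∧ ∃ c : ℝ, 0 < c ∧ ∀ r ∈ Q, c * ψ (H r) ≤ dist x r}

/-- The power function `ψ_c (t) = 1 / t ^ c`. -/
noncomputable def psi (c : ℝ) : ℝ → ℝ := fun t => 1 / t ^ c

/-- The Dirichlet exponent of `(M, Q, H)`: the supremum in `[0,∞]` of all `c > 0` such that `ψ_c`
is a Dirichlet function (`0` if there is no such `c`). -/
noncomputable def dirichletExponent {X : Type*} [MetricSpace X] (M Q : Set X) (H : X → ℝ) : ℝ≥0∞ :=
  sSup {a : ℝ≥0∞ | ∃ c : ℝ, 0 < c ∧ IsDirichletFunction M Q H (psi c) ∧ a = ENNReal.ofReal c}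

end Triples

/-! ### Rational points of `ℝ^d`

`ℝ^d` is `Fin d → ℝ`, whose metric is the one of the max norm. -/

/-- The set `ℚ^d ⊆ ℝ^d`. -/
def ratPoints (d : ℕ) : Set (Fin d → ℝ) :=
  {x | ∃ r : Fin d → ℚ, ∀ i, x i = (r i : ℝ)}

/-- The height of a rational point: its least common denominator, i.e. the `q` of its reduced form
`p / q` with `p ∈ ℤ^d`, `q ≥ 1` and `gcd (p₁, …, p_d, q) = 1`. -/
noncomputable def height {d : ℕ} (x : Fin d → ℝ) : ℕ :=
  sInf {q : ℕ | 0 < q ∧ ∃ p : Fin d → ℤ, ∀ i, x i = (p i : ℝ) / (q : ℝ)}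

/-- `ψ` is a Dirichlet function for intrinsic approximation on `M`, that is, for the triple
`(M, ℚ^d ∩ M, H)`. -/
def IsIntrinsicDirichlet {d : ℕ} (M : Set (Fin d → ℝ)) (ψ : ℝ → ℝ) : Prop :=
  IsDirichletFunction M (ratPoints d ∩ M) (fun x => (height x : ℝ)) ψ

/-- `BA_M (ψ)`, the set of `ψ`-intrinsically badly approximable points of `M`. -/
def BA {d : ℕ} (M : Set (Fin d → ℝ)) (ψ : ℝ → ℝ) : Set (Fin d → ℝ) :=
  BadlyApproximable M (ratPoints d ∩ M) (fun x => (height x : ℝ)) ψ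

/-- The intrinsic Dirichlet exponent of `M`. -/
noncomputable def intrinsicDirichletExponent {d : ℕ} (M : Set (Fin d → ℝ)) : ℝ≥0∞ :=
  dirichletExponent M (ratPoints d ∩ M) (fun x => (height x : ℝ))

/-! ### The constant `c(k,d)` -/

/-- `[n, m] = (n + m choose m)`. -/
def brk (n m : ℕ) : ℕ := (n + m).choose m

/-- The partial sum `[k-1,1] + [k-1,2] + ⋯ + [k-1,n]`. -/
def brkSum (k n : ℕ) : ℕ := ∑ j ∈ Finset.Icc 1 n, brk (k - 1) j

/-- `n_{k,d}`: the largest `n` with `[k-1,1] + ⋯ + [k-1,n] ≤ d`. Each term is at least `1`, so such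
an `n` is at most `d`. -/
def nkd (k d : ℕ) : ℕ := Nat.findGreatest (fun n => brkSum k n ≤ d) d

/-- `m_{k,d} = d - ([k-1,1] + ⋯ + [k-1,n_{k,d}])`, which is nonnegative by the choice of
`n_{k,d}`. -/
def mkd (k d : ℕ) : ℕ := d - brkSum k (nkd k d)

/-- `N_{k,d} = 1 [k-1,1] + 2 [k-1,2] + ⋯ + n_{k,d} [k-1,n_{k,d}] + (n_{k,d} + 1) m_{k,d}`. -/
def Nkd (k d : ℕ) : ℕ :=
  ∑ j ∈ Finset.Icc 1 (nkd k d), j * brk (k - 1) j + (nkd k d + 1) * mkd k d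

/-- `c(k,d) = (d + 1) / N_{k,d}`. -/
noncomputable def ckd (k d : ℕ) : ℝ := ((d : ℝ) + 1) / (Nkd k d : ℝ)

/-! ### Nondegenerate submanifolds of `ℝ^d` -/

/-- `Ψ : U → M`, with `U ⊆ ℝ^k` open, is a (smooth) local parametrization of `M ⊆ ℝ^d`: a smooth
immersion which is a homeomorphism of `U` onto a relatively open subset of `M`.
The values of `Ψ` outside `U` are irrelevant. -/
structure IsLocalParametrization {k d : ℕ} (M : Set (Fin d → ℝ)) (U : Set (Fin k → ℝ))
    (Ψ : (Fin k → ℝ) → (Fin d → ℝ)) : Prop where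
  isOpen : IsOpen U
  contDiffOn : ContDiffOn ℝ ∞ Ψ U
  immersion : ∀ u ∈ U, Function.Injective (fderiv ℝ Ψ u)
  isEmbedding : IsEmbedding (U.domRestrict Ψ)
  image_eq : ∃ W : Set (Fin d → ℝ), IsOpen W ∧ Ψ '' U = M ∩ W

/-- `M` is a `k`-dimensional smooth (embedded) submanifold of `ℝ^d`. -/
def IsSubmanifold {d : ℕ} (k : ℕ) (M : Set (Fin d → ℝ)) : Prop :=
  ∀ x ∈ M, ∃ (U : Set (Fin k → ℝ)) (Ψ : (Fin k → ℝ) → (Fin d → ℝ)),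
    IsLocalParametrization M U Ψ ∧ x ∈ Ψ '' U

/-- The span of all partial derivatives `∂_{s 1} ⋯ ∂_{s i} Ψ (v)` of orders `1 ≤ i ≤ j`. If `Ψ` is
a local parametrization of `M` with `Ψ v = x`, this is the tangent space of order `j` of `M` at
`x`. -/
noncomputable def osculatingSpace {k d : ℕ} (Ψ : (Fin k → ℝ) → (Fin d → ℝ)) (v : Fin k → ℝ)
    (j : ℕ) : Submodule ℝ (Fin d → ℝ) :=
  Submodule.span ℝ {w | ∃ i : ℕ, 1 ≤ i ∧ i ≤ j ∧ ∃ s : Fin i → Fin k,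
    w = iteratedFDeriv ℝ i Ψ v (fun l => Pi.single (s l) (1 : ℝ))}

/-- `x` is a `D`-nondegenerate point of the `k`-dimensional submanifold `M`: the tangent space of
order `D` of `M` at `x`, computed in a local parametrization around `x`, is all of `ℝ^d` (by the
chain rule, the choice of the local parametrization does not matter). -/
def IsNondegenerateAt {d : ℕ} (k D : ℕ) (M : Set (Fin d → ℝ)) (x : Fin d → ℝ) : Prop :=
  ∃ (U : Set (Fin k → ℝ)) (Ψ : (Fin k → ℝ) → (Fin d → ℝ)),
    IsLocalParametrization M U Ψ ∧ ∃ v ∈ U, Ψ v = x ∧ osculatingSpace Ψ v D = ⊤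

/-- `M` is a nondegenerate `k`-dimensional submanifold of `ℝ^d`: some point of `M` is
`D`-nondegenerate for some `D ≥ 1`. -/
def IsNondegenerateSubmanifold {d : ℕ} (k : ℕ) (M : Set (Fin d → ℝ)) : Prop :=
  IsSubmanifold k M ∧ ∃ x ∈ M, ∃ D : ℕ, 1 ≤ D ∧ IsNondegenerateAt k D M x

end IntrinsicApprox

open IntrinsicApprox

namespace IntrinsicApprox

/-! The lower bound on the dimension rests on a simplex argument in parameter space. Let `Ψ` be a
chart that is nondegenerate at `v`, let `f = (1, Ψ)`, and take `d + 1` parameters in a ball of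
radius `ρ` near `v`. Expand the rows of the determinant of the values of `f` by Taylor's formula at
the centre of the ball, up to order `n_{k,d}`. By multilinearity it is a sum of determinants with
one Taylor term per row, and those in which a monomial occurs twice vanish. Since there are `[k-1,
j]` monomials of degree `j`, the cheapest surviving choice has total degree `N_{k,d}`, so the
determinant is `O(ρ^N)` (`exists_abs_det_le`). If the points are rational, multiplying by their
denominators gives an integer. Hence the rational points in the ball with `H^(d+1) * C * ρ^N < 1`
all lie in one affine hyperplane (`det_cons_eq_zero`, `exists_functional_of_det_eq_zero`).

Nondegeneracy makes the trace of any hyperplane on the chart porous, with constants independent of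
the hyperplane: near `v` a nonzero functional of `f` looks at scale `ρ` like a polynomial with
controlled coefficients (`exists_porous`). So each ball of radius `ρ` contains one of radius `δ * ρ`
free of those rational points (`exists_ball_disjoint_rational`).

Iterating this, with an `m`-adic grid placed in each free ball, gives a Cantor set whose points keep
distance comparable to `ρ_n` from the rational points excluded at scale `ρ_n` (`exists_cantor_map`).
The first scale excluding a given rational point is bounded below by a multiple of `H^(-(d+1)/N)`,
and so the Cantor set maps into `BA_M` (`le_dimH_BA`). Its dimension is at least `k * log m / (log m
+ log (4/δ))`, which tends to `k` as `m → ∞` with `δ` fixed. The upper bound is the dimension of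
`M`. As `k ≥ 1`, badly approximable points exist, and a single one rules out every faster Dirichlet
function. -/

/-! ### Hausdorff dimension of images of inverse Hölder maps -/

/-- If the inverse of `g` on a set `s` is `t`-Hölder, then `t * dimH s ≤ dimH (g '' s)`. -/
theorem mul_dimH_le_dimH_image {X Y : Type*} [MetricSpace X] [MetricSpace Y] {s : Set X}
    {g : X → Y} {K t : ℝ} (ht : 0 < t)
    (hg : ∀ x ∈ s, ∀ y ∈ s, dist x y ≤ K * dist (g x) (g y) ^ t) :
    ENNReal.ofReal t * dimH s ≤ dimH (g '' s) := by
  rcases s.eq_empty_or_nonempty with rfl | ⟨x₀, hx₀⟩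
  · simp
  have : Nonempty X := ⟨x₀⟩
  have hinj : InjOn g s := by
    intro x hx y hy h
    have := hg x hx y hy
    rw [h, dist_self, Real.zero_rpow ht.ne', mul_zero] at this
    exact dist_le_zero.1 this
  have hinv : ∀ x ∈ s, Function.invFunOn g s (g x) = x := fun x hx =>
    hinj.leftInvOn_invFunOn hx
  have hH : HolderOnWith K.toNNReal t.toNNReal (Function.invFunOn g s) (g '' s) := by
    rintro _ ⟨x, hx, rfl⟩ _ ⟨y, hy, rfl⟩
    rw [hinv x hx, hinv y hy, edist_dist, edist_dist, Real.coe_toNNReal _ ht.le,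
      ENNReal.ofReal_rpow_of_nonneg dist_nonneg ht.le]
    change _ ≤ ENNReal.ofReal K * _
    rw [← ENNReal.ofReal_mul' (Real.rpow_nonneg dist_nonneg _)]
    exact ENNReal.ofReal_le_ofReal (hg x hx y hy)
  have himg : Function.invFunOn g s '' (g '' s) = s := by
    rw [image_image]
    exact (image_congr hinv).trans (image_id' s)
  have h := hH.dimH_image_le (Real.toNNReal_pos.2 ht)
  rw [himg] at h
  have ht0 : (ENNReal.ofReal t) ≠ 0 := by simpa using ht
  calc ENNReal.ofReal t * dimH s ≤ ENNReal.ofReal t * (dimH (g '' s) / ENNReal.ofReal t) := by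
        gcongr; exact h
    _ = dimH (g '' s) := ENNReal.mul_div_cancel ht0 ENNReal.ofReal_ne_top

theorem dimH_unitBox (k : ℕ) : dimH (univ.pi fun _ : Fin k => Ico (0 : ℝ) 1) = k := by
  have h : (interior (univ.pi fun _ : Fin k => Ico (0 : ℝ) 1)).Nonempty := by
    rw [interior_pi_set finite_univ]
    refine ⟨fun _ => 1 / 2, fun i _ => ?_⟩
    rw [interior_Ico]
    norm_num
  rw [Real.dimH_of_nonempty_interior h]
  simp

/-! ### A Cantor-type construction -/

/-- The `n`-th digit of `x` in base `m`. -/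
noncomputable def baseDigit (m : ℕ) (x : ℝ) (n : ℕ) : ℤ :=
  ⌊(m : ℝ) ^ (n + 1) * x⌋ - m * ⌊(m : ℝ) ^ n * x⌋

theorem baseDigit_nonneg (m : ℕ) (x : ℝ) (n : ℕ) : 0 ≤ baseDigit m x n := by
  have h : (m : ℤ) * ⌊(m : ℝ) ^ n * x⌋ ≤ ⌊(m : ℝ) ^ (n + 1) * x⌋ := by
    rw [Int.le_floor]
    push_cast
    have := Int.floor_le ((m : ℝ) ^ n * x)
    calc (m : ℝ) * ⌊(m : ℝ) ^ n * x⌋ ≤ m * ((m : ℝ) ^ n * x) := by gcongr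
      _ = _ := by ring
  unfold baseDigit
  omega

theorem baseDigit_add_one_le {m : ℕ} (hm : 0 < m) (x : ℝ) (n : ℕ) :
    baseDigit m x n + 1 ≤ m := by
  have h : ⌊(m : ℝ) ^ (n + 1) * x⌋ < (m : ℤ) * ⌊(m : ℝ) ^ n * x⌋ + m := by
    rw [Int.floor_lt]
    push_cast
    have := Int.lt_floor_add_one ((m : ℝ) ^ n * x)
    calc (m : ℝ) ^ (n + 1) * x = m * ((m : ℝ) ^ n * x) := by ring
      _ < m * (⌊(m : ℝ) ^ n * x⌋ + 1) := by gcongr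
      _ = _ := by ring
  unfold baseDigit
  omega

/-- The digits determine these floors recursively; membership in `[0,1)` supplies the common
starting value `⌊x⌋ = ⌊y⌋ = 0`. -/
theorem floor_eq_of_baseDigit_eq {m : ℕ} {x y : ℝ} (hx : x ∈ Ico (0 : ℝ) 1)
    (hy : y ∈ Ico (0 : ℝ) 1) (n : ℕ) (h : ∀ j < n, baseDigit m x j = baseDigit m y j) :
    ⌊(m : ℝ) ^ n * x⌋ = ⌊(m : ℝ) ^ n * y⌋ := by
  induction n with
  | zero => simp [Int.floor_eq_zero_iff.2 hx, Int.floor_eq_zero_iff.2 hy]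
  | succ n ih =>
    have h1 := ih fun j hj => h j (by omega)
    have h2 := h n (by omega)
    unfold baseDigit at h2
    rw [h1] at h2
    omega

theorem dist_le_of_baseDigit_eq {m : ℕ} (hm : 0 < m) {x y : ℝ} (hx : x ∈ Ico (0 : ℝ) 1)
    (hy : y ∈ Ico (0 : ℝ) 1) (n : ℕ) (h : ∀ j < n, baseDigit m x j = baseDigit m y j) :
    dist x y ≤ ((m : ℝ) ^ n)⁻¹ := by
  have hf := floor_eq_of_baseDigit_eq hx hy n h
  have hm' : (0 : ℝ) < (m : ℝ) ^ n := by positivity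
  have := (Int.abs_sub_lt_one_of_floor_eq_floor hf).le
  rw [← mul_sub, abs_mul, abs_of_pos hm'] at this
  rw [Real.dist_eq, ← one_div, le_div_iff₀ hm']
  linarith

/-- Centres of a nested sequence of balls: inside the ball with centre `c a ρ` and radius
`δ * ρ / 2` one chooses the cell of an `m`-adic grid prescribed by the digits of `x`. -/
noncomputable def cantorCentre {k : ℕ} (c : (Fin k → ℝ) → ℝ → Fin k → ℝ) (v : Fin k → ℝ)
    (ρ : ℕ → ℝ) (δ : ℝ) (m : ℕ) (x : Fin k → ℝ) : ℕ → Fin k → ℝ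
  | 0 => v
  | n + 1 => fun i => c (cantorCentre c v ρ δ m x n) (ρ n) i +
      δ * ρ n / 2 * ((2 * (baseDigit m (x i) n : ℝ) + 1) / m - 1)

/-- If every ball of radius `ρ ≤ r` contains a ball of radius `δ * ρ` that misses `Z ρ`, then
there is a set of points staying away from all the sets `Z (r * (δ / (4 * m)) ^ n)`, onto which the
unit box can be mapped by a map with Hölder inverse. -/
theorem exists_cantor_map {k : ℕ} {v : Fin k → ℝ} {r δ : ℝ} (hr : 0 < r) (hδ : 0 < δ)
    (hδ1 : δ ≤ 1) {Z : ℝ → Set (Fin k → ℝ)}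
    (hZ : ∀ a ∈ Metric.closedBall v r, ∀ ρ, 0 < ρ → ρ ≤ r → ∃ x,
      Metric.closedBall x (δ * ρ) ⊆ Metric.closedBall a ρ ∧
      Disjoint (Metric.closedBall x (δ * ρ)) (Z ρ))
    {m : ℕ} (hm : 2 ≤ m) {t : ℝ} (ht : 0 < t) (htm : (δ / (4 * m)) ^ t = (m : ℝ)⁻¹) :
    ∃ (g : (Fin k → ℝ) → (Fin k → ℝ)) (K : ℝ), 0 ≤ K ∧
      (∀ x, g x ∈ Metric.closedBall v r) ∧
      (∀ x, ∀ n : ℕ, ∀ u ∈ Z (r * (δ / (4 * m)) ^ n), δ * (r * (δ / (4 * m)) ^ n) / 2 ≤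
        dist (g x) u) ∧
      ∀ x ∈ univ.pi fun _ : Fin k => Ico (0 : ℝ) 1, ∀ y ∈ univ.pi fun _ : Fin k => Ico (0 : ℝ) 1,
        dist x y ≤ K * dist (g x) (g y) ^ t := by
  have hm0 : (0 : ℝ) < m := by positivity
  set lam : ℝ := δ / (4 * m) with hlam
  have hlam0 : 0 < lam := by positivity
  have hlam1 : lam ≤ 1 := by
    rw [hlam, div_le_one (by positivity)]
    have : (2 : ℝ) ≤ m := by exact_mod_cast hm
    linarith
  set ρ : ℕ → ℝ := fun n => r * lam ^ n with hρ
  have hρ0 : ∀ n, 0 < ρ n := fun n => by positivity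
  have hρr : ∀ n, ρ n ≤ r := fun n => by
    have : lam ^ n ≤ 1 := pow_le_one₀ hlam0.le hlam1
    simp only [hρ]
    nlinarith
  -- A grid cell in the ball of radius `δ * ρ n / 2` has half-width `δ * ρ n / (2 * m) = 2 * ρ (n +
  -- 1)`. The next ball thus fills only half of its cell, which leaves a gap between balls in
  -- different cells.
  have hρs : ∀ n, ρ (n + 1) = δ * ρ n / (4 * m) := fun n => by
    simp only [hρ, hlam, pow_succ]
    field_simp
  choose! c hc1 hc2 using hZ
  set A := cantorCentre c v ρ δ m with hA
  have hcell : ∀ x n, Metric.closedBall (A x (n + 1)) (ρ (n + 1)) ⊆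
      Metric.closedBall (c (A x n) (ρ n)) (δ * ρ n / 2) := by
    intro x n
    apply Metric.closedBall_subset_closedBall'
    have hd : dist (A x (n + 1)) (c (A x n) (ρ n)) ≤ δ * ρ n / 2 * (1 - 1 / m) := by
      have h0 := hρ0 n
      have h1m : (1 : ℝ) / m ≤ 1 := by
        rw [div_le_one hm0]
        exact_mod_cast (by omega : 1 ≤ m)
      refine (dist_pi_le_iff (mul_nonneg (by positivity) (by linarith))).2 fun i => ?_
      have e : A x (n + 1) i = c (A x n) (ρ n) i +
        δ * ρ n / 2 * ((2 * (baseDigit m (x i) n : ℝ) + 1) / m - 1) := rfl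
      rw [e, Real.dist_eq, add_sub_cancel_left, abs_mul, abs_of_pos (by positivity)]
      gcongr
      have h1 : (0 : ℝ) ≤ baseDigit m (x i) n := by exact_mod_cast baseDigit_nonneg m (x i) n
      have h2 : (baseDigit m (x i) n : ℝ) + 1 ≤ m := by
        exact_mod_cast baseDigit_add_one_le (by omega : 0 < m) (x i) n
      rw [abs_le]
      constructor
      · have : 0 ≤ 2 * (baseDigit m (x i) n : ℝ) / m := by positivity
        rw [add_div]
        linarith
      · have : (2 * (baseDigit m (x i) n : ℝ) + 1) / m + 1 / m ≤ 2 := by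
          rw [← add_div, div_le_iff₀ hm0]
          linarith
        linarith
    have : δ * ρ n / 2 * (1 / m) = 2 * ρ (n + 1) := by
      rw [hρs]
      field_simp
      norm_num
    have := hρ0 (n + 1)
    nlinarith
  have hhalf : ∀ (n : ℕ) (x : Fin k → ℝ), Metric.closedBall x (δ * ρ n / 2) ⊆ Metric.closedBall x (δ * ρ n) :=
    fun n x => Metric.closedBall_subset_closedBall (by have := hρ0 n; nlinarith)
  have hmem : ∀ x n, Metric.closedBall (A x n) (ρ n) ⊆ Metric.closedBall v r := by
    intro x n
    induction n with
    | zero => simp [hA, cantorCentre, hρ]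
    | succ n ih =>
      have hmem : A x n ∈ Metric.closedBall v r :=
        ih (Metric.mem_closedBall_self (hρ0 n).le)
      exact (hcell x n).trans ((hhalf n _).trans ((hc1 _ hmem _ (hρ0 n) (hρr n)).trans ih))
  have hAmem : ∀ x n, A x n ∈ Metric.closedBall v r := fun x n =>
    hmem x n (Metric.mem_closedBall_self (hρ0 n).le)
  have hnest : ∀ x n, Metric.closedBall (A x (n + 1)) (ρ (n + 1)) ⊆
      Metric.closedBall (A x n) (ρ n) := fun x n =>
    (hcell x n).trans ((hhalf n _).trans (hc1 _ (hAmem x n) _ (hρ0 n) (hρr n)))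
  have hlim : ∀ x, (⋂ n, Metric.closedBall (A x n) (ρ n)).Nonempty := fun x =>
    IsCompact.nonempty_iInter_of_sequence_nonempty_isCompact_isClosed
      (fun n => Metric.closedBall (A x n) (ρ n)) (hnest x)
      (fun n => ⟨_, Metric.mem_closedBall_self (hρ0 n).le⟩) (isCompact_closedBall (A x 0) (ρ 0))
      fun _ => Metric.isClosed_closedBall
  choose g hg using hlim
  have hg' : ∀ x n, g x ∈ Metric.closedBall (A x n) (ρ n) := fun x n => mem_iInter.1 (hg x) n
  refine ⟨g, (2 * r * lam)⁻¹ ^ t, by positivity, fun x => hmem x 0 (hg' x 0), fun x n u hu => ?_,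
    fun x hx y hy => ?_⟩
  -- The free ball has radius `δ * ρ n`, but the construction continues in the concentric ball of
  -- half that radius; the other half is the distance kept from `Z`.
  · have h1 : dist (g x) (c (A x n) (ρ n)) ≤ δ * ρ n / 2 := hcell x n (hg' x (n + 1))
    have h2 : δ * ρ n < dist u (c (A x n) (ρ n)) := by
      by_contra hcon
      exact Set.disjoint_left.1 (hc2 _ (hAmem x n) _ (hρ0 n) (hρr n))
        (Metric.mem_closedBall.2 (not_lt.1 hcon)) hu
    have h3 := dist_triangle u (g x) (c (A x n) (ρ n))
    rw [dist_comm u (g x)] at h3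
    change δ * ρ n / 2 ≤ _
    linarith
  · by_cases hex : ∃ n, ∃ i, baseDigit m (x i) n ≠ baseDigit m (y i) n
    · classical
      obtain ⟨i, hi⟩ := Nat.find_spec hex
      -- At the first differing digit `n` the two points still share their ball of level `n`, but
      -- choose different cells in it.
      set n := Nat.find hex
      have hlt : ∀ j < n, ∀ i, baseDigit m (x i) j = baseDigit m (y i) j := by
        intro j hj i
        by_contra hne
        exact Nat.find_min hex hj ⟨i, hne⟩
      have hxy : dist x y ≤ ((m : ℝ) ^ n)⁻¹ :=
        (dist_pi_le_iff (by positivity)).2 fun i =>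
          dist_le_of_baseDigit_eq (by omega) (hx i trivial) (hy i trivial) n fun j hj => hlt j hj i
      have hAeq : ∀ j ≤ n, A x j = A y j := by
        intro j hj
        induction j with
        | zero => rfl
        | succ j ih =>
          have := ih (by omega)
          funext i
          simp only [hA, cantorCentre] at this ⊢
          rw [this, hlt j (by omega) i]
      have hsep : 2 * ρ (n + 1) ≤ dist (g x) (g y) := by
        have h1 : 4 * ρ (n + 1) ≤ dist (A x (n + 1)) (A y (n + 1)) := by
          refine le_trans ?_ (dist_le_pi_dist _ _ i)
          have ex : A x (n + 1) i = c (A x n) (ρ n) i +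
            δ * ρ n / 2 * ((2 * (baseDigit m (x i) n : ℝ) + 1) / m - 1) := rfl
          have ey : A y (n + 1) i = c (A y n) (ρ n) i +
            δ * ρ n / 2 * ((2 * (baseDigit m (y i) n : ℝ) + 1) / m - 1) := rfl
          have h0 := hρ0 n
          have hab : (1 : ℝ) ≤ |(baseDigit m (x i) n : ℝ) - baseDigit m (y i) n| := by
            exact_mod_cast Int.one_le_abs (sub_ne_zero.2 hi)
          rw [ex, ey, ← hAeq n le_rfl, Real.dist_eq, hρs]
          have : c (A x n) (ρ n) i + δ * ρ n / 2 * ((2 * (baseDigit m (x i) n : ℝ) + 1) / m - 1) -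
              (c (A x n) (ρ n) i + δ * ρ n / 2 * ((2 * (baseDigit m (y i) n : ℝ) + 1) / m - 1)) =
              δ * ρ n / m * ((baseDigit m (x i) n : ℝ) - baseDigit m (y i) n) := by
            field_simp
            ring
          rw [this, abs_mul, abs_of_pos (by positivity)]
          calc 4 * (δ * ρ n / (4 * m)) = δ * ρ n / m * 1 := by field_simp
            _ ≤ _ := by gcongr
        have h2 := hg' x (n + 1)
        have h3 := hg' y (n + 1)
        rw [Metric.mem_closedBall] at h2 h3
        have h4 := dist_triangle4 (A x (n + 1)) (g x) (g y) (A y (n + 1))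
        rw [dist_comm (A x (n + 1)) (g x)] at h4
        linarith
      calc dist x y ≤ ((m : ℝ) ^ n)⁻¹ := hxy
        _ = (lam ^ n) ^ t := by
          rw [← Real.rpow_pow_comm hlam0.le, htm, inv_pow]
        _ = (2 * r * lam)⁻¹ ^ t * (2 * ρ (n + 1)) ^ t := by
          rw [← Real.mul_rpow (by positivity) (by have := hρ0 (n + 1); positivity)]
          congr 1
          simp only [hρ, pow_succ]
          field_simp
        _ ≤ _ := by
          have := hρ0 (n + 1)
          gcongr
    · push Not at hex
      have hxy : ∀ n : ℕ, dist x y ≤ ((m : ℝ)⁻¹) ^ n := fun n => by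
        rw [inv_pow]
        exact (dist_pi_le_iff (by positivity)).2 fun i =>
          dist_le_of_baseDigit_eq (by omega) (hx i trivial) (hy i trivial) n fun j _ => hex j i
      have h0 : dist x y ≤ 0 := ge_of_tendsto' (tendsto_pow_atTop_nhds_zero_of_lt_one
        (by positivity) (inv_lt_one_of_one_lt₀ (by exact_mod_cast (by omega : 1 < m)))) hxy
      refine h0.trans ?_
      positivity

/-! ### Iterated directional derivatives and their symmetry -/

section ListDeriv

variable {E F : Type*} [NormedAddCommGroup E] [NormedSpace ℝ E] [NormedAddCommGroup F]
  [NormedSpace ℝ F]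

/-- The iterated directional derivative of `f` along the vectors of a list. -/
noncomputable def listDeriv (f : E → F) : List E → E → F
  | [] => f
  | v :: l => fun x => fderiv ℝ (listDeriv f l) x v

theorem contDiff_listDeriv {f : E → F} (hf : ContDiff ℝ ∞ f) (l : List E) :
    ContDiff ℝ ∞ (listDeriv f l) := by
  induction l with
  | nil => exact hf
  | cons v l ih => exact (ih.fderiv_right (m := ∞) (by simp)).clm_apply contDiff_const

/-- Permutations are generated by adjacent transpositions, and for these the claim is the symmetry
of the second derivative of the remaining iterated derivative. -/
theorem listDeriv_perm {f : E → F} (hf : ContDiff ℝ ∞ f) {l l' : List E} (h : l.Perm l') :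
    listDeriv f l = listDeriv f l' := by
  induction h with
  | nil => rfl
  | cons v _ ih => simp only [listDeriv, ih]
  | trans _ _ ih1 ih2 => exact ih1.trans ih2
  | swap v w l =>
    have hs := contDiff_listDeriv hf l
    have hd : Differentiable ℝ (fderiv ℝ (listDeriv f l)) :=
      (hs.fderiv_right (m := 1) (by norm_cast)).differentiable one_ne_zero
    funext x
    have hsymm : IsSymmSndFDerivAt ℝ (listDeriv f l) x :=
      hs.contDiffAt.isSymmSndFDerivAt (by simp only [minSmoothness_of_isRCLikeNormedField]; norm_cast)
    have key : ∀ v w, listDeriv f (v :: w :: l) x =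
        fderiv ℝ (fderiv ℝ (listDeriv f l)) x v w := by
      intro v w
      simp only [listDeriv]
      rw [fderiv_clm_apply (hd x) (differentiableAt_const _)]
      simp
    rw [key, key, hsymm.eq]

theorem iteratedFDeriv_eq_listDeriv {f : E → F} (hf : ContDiff ℝ ∞ f) {n : ℕ} (x : E)
    (v : Fin n → E) : iteratedFDeriv ℝ n f x v = listDeriv f (List.ofFn v) x := by
  induction n generalizing x with
  | zero => simp [listDeriv]
  | succ n ih =>
    have hd : Differentiable ℝ (iteratedFDeriv ℝ n f) :=
      hf.differentiable_iteratedFDeriv (by exact_mod_cast WithTop.coe_lt_coe.2 (ENat.natCast_lt_top n))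
    rw [iteratedFDeriv_succ_apply_left, List.ofFn_succ, listDeriv,
      ← fderiv_continuousMultilinear_apply_const_apply (hd x)]
    have : (fun y => iteratedFDeriv ℝ n f y (Fin.tail v)) =
        listDeriv f (List.ofFn fun i => v i.succ) := funext fun y => ih y _
    rw [this]

/-- The iterated derivatives of a smooth function are symmetric. -/
theorem iteratedFDeriv_congr_multiset {f : E → F} (hf : ContDiff ℝ ∞ f) {n : ℕ} (x : E)
    {v w : Fin n → E} (h : Finset.univ.val.map v = Finset.univ.val.map w) :
    iteratedFDeriv ℝ n f x v = iteratedFDeriv ℝ n f x w := by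
  rw [Fin.univ_val_map, Fin.univ_val_map, Multiset.coe_eq_coe] at h
  rw [iteratedFDeriv_eq_listDeriv hf, iteratedFDeriv_eq_listDeriv hf, listDeriv_perm hf h]

/-! ### Taylor's formula -/

theorem iteratedDeriv_comp_line {f : E → F} (hf : ContDiff ℝ ∞ f) (a h : E) (n : ℕ) (t : ℝ) :
    iteratedDeriv n (fun t : ℝ => f (a + t • h)) t =
      iteratedFDeriv ℝ n f (a + t • h) fun _ => h := by
  have e : (fun t : ℝ => f (a + t • h)) =
      (fun z => f (a + z)) ∘ (ContinuousLinearMap.smulRight (1 : ℝ →L[ℝ] ℝ) h) := by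
    funext t
    simp
  have hs : ContDiff ℝ ∞ fun z => f (a + z) := hf.comp (contDiff_const.add contDiff_id)
  rw [iteratedDeriv_eq_iteratedFDeriv, e, ContinuousLinearMap.iteratedFDeriv_comp_right _ hs t
    (i := n) (by exact_mod_cast le_top), iteratedFDeriv_comp_add_left]
  simp

/-- Taylor's formula with a remainder that is uniform in the base point. -/
theorem exists_taylor_bound [FiniteDimensional ℝ E] {f : E → F} (hf : ContDiff ℝ ∞ f) (v : E)
    (n : ℕ) : ∃ C, 0 ≤ C ∧ ∀ a ∈ Metric.closedBall v 1, ∀ h : E, ‖h‖ ≤ 1 →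
      ‖f (a + h) - ∑ j ∈ Finset.range (n + 1),
        ((j.factorial : ℝ)⁻¹) • iteratedFDeriv ℝ j f a (fun _ => h)‖ ≤ C * ‖h‖ ^ (n + 1) := by
  have hcont : Continuous fun x => ‖iteratedFDeriv ℝ (n + 1) f x‖ :=
    (hf.continuous_iteratedFDeriv (by exact_mod_cast le_top)).norm
  have : ProperSpace E := FiniteDimensional.proper ℝ E
  -- Radius `2` contains every segment from `a` to `a + h` with `a` in the unit ball and `‖h‖ ≤ 1`;
  -- the one-variable formula is applied along that segment.
  obtain ⟨C, hC⟩ := ((isCompact_closedBall v 2).image hcont).bddAbove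
  rw [mem_upperBounds, forall_mem_image] at hC
  have hC0 : 0 ≤ C := (norm_nonneg _).trans (hC (Metric.mem_closedBall_self (by norm_num)))
  refine ⟨C, hC0, fun a ha h hh => ?_⟩
  have hg : ContDiff ℝ ∞ fun t : ℝ => f (a + t • h) :=
    hf.comp (contDiff_const.add (contDiff_id.smul contDiff_const))
  have hiter : ∀ j : ℕ, ∀ t ∈ Icc (0 : ℝ) 1,
      iteratedDerivWithin j (fun t : ℝ => f (a + t • h)) (Icc 0 1) t =
        iteratedFDeriv ℝ j f (a + t • h) fun _ => h := fun j t ht => by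
    rw [iteratedDerivWithin_eq_iteratedDeriv uniqueDiffOn_Icc_zero_one
      (hg.contDiffAt.of_le (by exact_mod_cast le_top)) ht, iteratedDeriv_comp_line hf]
  have key := taylor_mean_remainder_bound (f := fun t : ℝ => f (a + t • h)) (a := 0) (b := 1)
    (x := 1) (n := n) (C := C * ‖h‖ ^ (n + 1)) zero_le_one
    (hg.contDiffOn.of_le (by exact_mod_cast le_top)) (right_mem_Icc.2 zero_le_one) (by
      intro t ht
      rw [hiter _ t ht]
      refine (ContinuousMultilinearMap.le_opNorm _ _).trans ?_
      rw [Finset.prod_const, Finset.card_univ, Fintype.card_fin]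
      gcongr
      apply hC
      rw [Metric.mem_closedBall, dist_eq_norm] at ha ⊢
      have h1 : ‖t • h‖ ≤ 1 := by
        rw [norm_smul, Real.norm_of_nonneg ht.1]
        exact mul_le_one₀ ht.2 (norm_nonneg _) hh
      calc ‖a + t • h - v‖ = ‖(a - v) + t • h‖ := by congr 1; abel
        _ ≤ ‖a - v‖ + ‖t • h‖ := norm_add_le _ _
        _ ≤ 2 := by linarith)
  rw [taylor_within_apply] at key
  simp only [sub_zero, one_pow, mul_one, one_smul] at key
  have e : ∀ j, iteratedDerivWithin j (fun t : ℝ => f (a + t • h)) (Icc 0 1) 0 =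
      iteratedFDeriv ℝ j f a fun _ => h := fun j => by
    rw [hiter j 0 (left_mem_Icc.2 zero_le_one), zero_smul, add_zero]
  simp only [e] at key
  refine key.trans (div_le_self (by positivity) ?_)
  exact_mod_cast n.factorial_pos

end ListDeriv

/-! ### Monomials and Taylor coefficients -/

/-- The monomials of degree `< n` in `k` variables. -/
abbrev MonoIndex (k n : ℕ) : Type := Σ j : Fin n, Sym (Fin k) j

/-- The value of a monomial. -/
def monoVal {k n : ℕ} (σ : MonoIndex k n) (h : Fin k → ℝ) : ℝ :=
  ((σ.2 : Multiset (Fin k)).map h).prod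

/-- The multiset of values of a finite sequence. -/
def seqSym {k j : ℕ} (s : Fin j → Fin k) : Sym (Fin k) j :=
  ⟨Finset.univ.val.map s, by simp⟩

/-- The Taylor coefficient of `f` at `x` that belongs to a monomial. -/
noncomputable def taylorCoeff {k n : ℕ} {F : Type*} [NormedAddCommGroup F] [NormedSpace ℝ F]
    (f : (Fin k → ℝ) → F) (x : Fin k → ℝ) (σ : MonoIndex k n) : F :=
  ((σ.1.val.factorial : ℝ)⁻¹) • ∑ s : Fin σ.1 → Fin k with seqSym s = σ.2,
    iteratedFDeriv ℝ σ.1 f x fun l => Pi.single (s l) (1 : ℝ)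

theorem prod_eq_seqSym {k j : ℕ} (s : Fin j → Fin k) (h : Fin k → ℝ) :
    ∏ l, h (s l) = ((seqSym s : Multiset (Fin k)).map h).prod := by
  simp [seqSym, Finset.prod, Function.comp_def]

theorem monoVal_smul {k n : ℕ} (σ : MonoIndex k n) (ρ : ℝ) (h : Fin k → ℝ) :
    monoVal σ (ρ • h) = ρ ^ (σ.1 : ℕ) * monoVal σ h := by
  have : (ρ • h) = fun i => ρ * h i := rfl
  rw [monoVal, monoVal, this, Multiset.prod_map_mul]
  simp

theorem continuous_monoVal {k n : ℕ} (σ : MonoIndex k n) : Continuous (monoVal σ) := by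
  unfold monoVal
  exact continuous_multiset_prod _ fun i _ => continuous_apply i

theorem abs_monoVal_le {k n : ℕ} (σ : MonoIndex k n) {h : Fin k → ℝ} {ρ : ℝ} (hh : ‖h‖ ≤ ρ) :
    |monoVal σ h| ≤ ρ ^ (σ.1 : ℕ) := by
  have h0 : 0 ≤ ρ := (norm_nonneg h).trans hh
  have key : ∀ m : Multiset (Fin k), |(m.map h).prod| ≤ ρ ^ m.card := by
    intro m
    induction m using Multiset.induction_on with
    | empty => simp
    | cons i m ih =>
      rw [Multiset.map_cons, Multiset.prod_cons, abs_mul, Multiset.card_cons, pow_succ, mul_comm]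
      gcongr
      exact (norm_le_pi_norm h i).trans hh
  simpa [monoVal] using key σ.2

section TaylorCoeff

variable {k : ℕ} {F : Type*} [NormedAddCommGroup F] [NormedSpace ℝ F]

theorem continuous_taylorCoeff {f : (Fin k → ℝ) → F} (hf : ContDiff ℝ ∞ f) {n : ℕ}
    (σ : MonoIndex k n) : Continuous fun x => taylorCoeff f x σ := by
  unfold taylorCoeff
  refine Continuous.const_smul (continuous_finsetSum _ fun s _ => ?_) _
  have : Continuous fun x => iteratedFDeriv ℝ (σ.1 : ℕ) f x :=
    hf.continuous_iteratedFDeriv (by exact_mod_cast le_top)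
  exact (ContinuousMultilinearMap.apply ℝ (fun _ : Fin σ.1 => Fin k → ℝ) F _).continuous.comp this

/-- Expand `h` in the standard basis and group the index sequences by their underlying multiset.
Keeping the inner sum avoids multinomial coefficients. -/
theorem iteratedFDeriv_diag_eq (f : (Fin k → ℝ) → F) (a h : Fin k → ℝ) (j : ℕ) :
    iteratedFDeriv ℝ j f a (fun _ => h) = ∑ σ : Sym (Fin k) j,
      ((σ : Multiset (Fin k)).map h).prod • ∑ s : Fin j → Fin k with seqSym s = σ,
        iteratedFDeriv ℝ j f a fun l => Pi.single (s l) (1 : ℝ) := by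
  have e : h = ∑ i, h i • (Pi.single i (1 : ℝ) : Fin k → ℝ) := by
    ext i
    simp [Finset.sum_apply, Pi.single_apply]
  have h1 : iteratedFDeriv ℝ j f a (fun _ => h) = ∑ s : Fin j → Fin k,
      (∏ l, h (s l)) • iteratedFDeriv ℝ j f a fun l => Pi.single (s l) (1 : ℝ) := by
    conv_lhs => rw [e]
    rw [ContinuousMultilinearMap.map_sum]
    exact Finset.sum_congr rfl fun s _ => ContinuousMultilinearMap.map_smul_univ _ _ _
  rw [h1, ← Finset.sum_fiberwise (s := Finset.univ) (g := seqSym)]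
  refine Finset.sum_congr rfl fun σ _ => ?_
  rw [Finset.smul_sum]
  refine Finset.sum_congr rfl fun s hs => ?_
  rw [prod_eq_seqSym, (Finset.mem_filter.1 hs).2]

/-- Taylor's formula in terms of monomials. -/
theorem exists_taylorCoeff_bound {f : (Fin k → ℝ) → F} (hf : ContDiff ℝ ∞ f) (v : Fin k → ℝ)
    (n : ℕ) : ∃ C, 0 ≤ C ∧ ∀ a ∈ Metric.closedBall v 1, ∀ h : Fin k → ℝ, ‖h‖ ≤ 1 →
      ‖f (a + h) - ∑ σ : MonoIndex k (n + 1), monoVal σ h • taylorCoeff f a σ‖ ≤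
        C * ‖h‖ ^ (n + 1) := by
  obtain ⟨C, hC0, hC⟩ := exists_taylor_bound hf v n
  refine ⟨C, hC0, fun a ha h hh => ?_⟩
  have e : ∑ σ : MonoIndex k (n + 1), monoVal σ h • taylorCoeff f a σ =
      ∑ j ∈ Finset.range (n + 1),
        ((j.factorial : ℝ)⁻¹) • iteratedFDeriv ℝ j f a (fun _ => h) := by
    rw [Finset.sum_range, Fintype.sum_sigma]
    refine Finset.sum_congr rfl fun j _ => ?_
    rw [iteratedFDeriv_diag_eq, Finset.smul_sum]
    refine Finset.sum_congr rfl fun σ _ => ?_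
    rw [monoVal, taylorCoeff, smul_comm]
  rw [e]
  exact hC a ha h hh

/-- The partial derivatives of a smooth function are multiples of its Taylor coefficients. -/
theorem exists_iteratedFDeriv_eq_smul_taylorCoeff {f : (Fin k → ℝ) → F} (hf : ContDiff ℝ ∞ f)
    {n : ℕ} (x : Fin k → ℝ) (j : Fin n) (s : Fin j → Fin k) :
    ∃ c : ℝ, iteratedFDeriv ℝ j f x (fun l => Pi.single (s l) (1 : ℝ)) =
      c • taylorCoeff f x (⟨j, seqSym s⟩ : MonoIndex k n) := by
  set S := (Finset.univ : Finset (Fin j → Fin k)).filter fun s' => seqSym s' = seqSym s with hS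
  -- By symmetry all summands of the Taylor coefficient coincide, so it is the partial derivative
  -- times the nonzero factor `S.card / j!`.
  have hconst : ∀ s' ∈ S, iteratedFDeriv ℝ j f x (fun l => Pi.single (s' l) (1 : ℝ)) =
      iteratedFDeriv ℝ j f x (fun l => Pi.single (s l) (1 : ℝ)) := by
    intro s' hs'
    apply iteratedFDeriv_congr_multiset hf
    have h1 : Finset.univ.val.map s' = Finset.univ.val.map s :=
      congrArg Subtype.val (Finset.mem_filter.1 hs').2
    have h2 := congrArg (Multiset.map fun i => (Pi.single i (1 : ℝ) : Fin k → ℝ)) h1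
    simpa only [Multiset.map_map, Function.comp_def] using h2
  have hcard : (S.card : ℝ) ≠ 0 := by
    have : s ∈ S := by simp [hS]
    exact_mod_cast (Finset.card_pos.2 ⟨s, this⟩).ne'
  have hfac : ((j : ℕ).factorial : ℝ) ≠ 0 := by exact_mod_cast (j : ℕ).factorial_ne_zero
  refine ⟨(S.card : ℝ)⁻¹ * (j : ℕ).factorial, ?_⟩
  rw [taylorCoeff]
  change _ = _ • _ • ∑ s ∈ S, _
  rw [Finset.sum_congr rfl hconst, Finset.sum_const, ← Nat.cast_smul_eq_nsmul ℝ, smul_smul,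
    smul_smul]
  field_simp
  rw [one_smul]

end TaylorCoeff

/-! ### The determinant estimate -/

/-- This is where the numbers `[k-1, j]` enter: they count the monomials of degree `j` in `k`
variables. -/
theorem card_sym_fin {k : ℕ} (hk : 1 ≤ k) (j : ℕ) :
    Fintype.card (Sym (Fin k) j) = brk (k - 1) j := by
  rw [Sym.card_sym_eq_choose, Fintype.card_fin, brk]
  congr 1
  omega

theorem brkSum_nkd_le (k d : ℕ) : brkSum k (nkd k d) ≤ d :=
  Nat.findGreatest_spec (P := fun n => brkSum k n ≤ d) (Nat.zero_le d) (by simp [brkSum])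

/-- All weights in `N_{k,d}` are at least `1` and the multiplicities add up to `d`, so `N_{k,d} ≥
d`. -/
theorem one_le_Nkd {k d : ℕ} (hd : 1 ≤ d) : 1 ≤ Nkd k d := by
  have h1 := brkSum_nkd_le k d
  have h2 : brkSum k (nkd k d) ≤ ∑ j ∈ Finset.Icc 1 (nkd k d), j * brk (k - 1) j :=
    Finset.sum_le_sum fun j hj => Nat.le_mul_of_pos_left _ (Finset.mem_Icc.1 hj).1
  have h3 : mkd k d ≤ (nkd k d + 1) * mkd k d := Nat.le_mul_of_pos_left _ (Nat.succ_pos _)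
  unfold Nkd
  have h4 : mkd k d = d - brkSum k (nkd k d) := rfl
  omega

/-- The degree of a monomial, and `n` for the remainder term. -/
def termDegree {k n : ℕ} : MonoIndex k n ⊕ Unit → ℕ :=
  Sum.elim (fun σ => (σ.1 : ℕ)) fun _ => n

/-- If `d + 1` terms of a Taylor expansion to the order `n` are chosen so that no monomial occurs
twice, then the sum of their degrees is at least the one obtained by taking all monomials and
filling up with remainder terms. -/
theorem le_sum_termDegree {k d n : ℕ} (hk : 1 ≤ k) (hn : brkSum k n ≤ d)
    (r : Fin (d + 1) → MonoIndex k (n + 1) ⊕ Unit)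
    (hr : ∀ i i' σ, r i = Sum.inl σ → r i' = Sum.inl σ → i = i') :
    ∑ j ∈ Finset.Icc 1 n, j * brk (k - 1) j + (n + 1) * (d - brkSum k n) ≤
      ∑ i, termDegree (r i) := by
  classical
  -- Count deficits `n + 1 - degree` instead of degrees: remainder terms have deficit zero and may
  -- repeat freely, while each monomial contributes its deficit at most once.
  have h1 : ∑ i, (n + 1 - termDegree (r i)) ≤ ∑ σ : MonoIndex k (n + 1), (n + 1 - (σ.1 : ℕ)) := by
    have e : ∑ σ : MonoIndex k (n + 1), (n + 1 - (σ.1 : ℕ)) =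
        ∑ s : MonoIndex k (n + 1) ⊕ Unit, (n + 1 - termDegree s) := by
      simp [termDegree]
    rw [e, ← Finset.sum_filter_add_sum_filter_not Finset.univ fun i => r i = Sum.inr ()]
    have z : ∑ i with r i = Sum.inr (), (n + 1 - termDegree (r i)) = 0 :=
      Finset.sum_eq_zero fun i hi => by
        rw [(Finset.mem_filter.1 hi).2]
        simp [termDegree]
    rw [z, zero_add]
    have hinj : Set.InjOn r (Finset.univ.filter fun i => ¬ r i = Sum.inr ()) := by
      intro i hi i' _ hii
      rcases hri : r i with σ | u
      · exact hr i i' σ hri (hii ▸ hri)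
      · exact absurd hri (by simpa using hi)
    rw [← Finset.sum_image (f := fun s => n + 1 - termDegree s) hinj]
    exact Finset.sum_le_sum_of_subset (Finset.subset_univ _)
  have hle : ∀ i, termDegree (r i) ≤ n + 1 := fun i => by
    rcases r i with σ | u
    · exact σ.1.2.le
    · exact le_rfl
  have h2 : ∑ i, (n + 1 - termDegree (r i)) + ∑ i, termDegree (r i) = (d + 1) * (n + 1) := by
    rw [← Finset.sum_add_distrib, Finset.sum_congr rfl fun i _ => Nat.sub_add_cancel (hle i)]
    simp
  -- The separate `n + 1` is the deficit of the constant monomial; it accounts for having `d + 1`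
  -- rows rather than `d`.
  have h3 : ∑ σ : MonoIndex k (n + 1), (n + 1 - (σ.1 : ℕ)) =
      (n + 1) + ∑ j ∈ Finset.Icc 1 n, (n + 1 - j) * brk (k - 1) j := by
    rw [Fintype.sum_sigma]
    have : ∀ j : Fin (n + 1), ∑ _σ : Sym (Fin k) j, (n + 1 - (j : ℕ)) =
        (n + 1 - (j : ℕ)) * brk (k - 1) j := fun j => by
      rw [Finset.sum_const, Finset.card_univ, card_sym_fin hk, smul_eq_mul, mul_comm]
    rw [Finset.sum_congr rfl fun j _ => this j,
      ← Finset.sum_range fun j => (n + 1 - j) * brk (k - 1) j, Finset.range_eq_Ico,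
      Finset.sum_eq_sum_Ico_succ_bot (Nat.succ_pos n)]
    congr 1
    simp [brk]
  have h4 : ∑ j ∈ Finset.Icc 1 n, (n + 1 - j) * brk (k - 1) j +
      ∑ j ∈ Finset.Icc 1 n, j * brk (k - 1) j = (n + 1) * brkSum k n := by
    rw [← Finset.sum_add_distrib, brkSum, Finset.mul_sum]
    refine Finset.sum_congr rfl fun j hj => ?_
    rw [← add_mul, Nat.sub_add_cancel (by have := (Finset.mem_Icc.1 hj).2; omega)]
  have h5 : (n + 1) * brkSum k n + (n + 1) * (d - brkSum k n) = (n + 1) * d := by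
    rw [← mul_add, Nat.add_sub_cancel' hn]
  have h6 : (d + 1) * (n + 1) = (n + 1) * d + (n + 1) := by ring
  omega

/-- A determinant whose rows are combinations of the vectors `b i s`, with coefficients of size
`ρ ^ termDegree s`, where `b i s` is independent of `i` if `s` is a monomial. -/
theorem abs_det_sum_le {k d : ℕ} (hk : 1 ≤ k) {ρ C : ℝ} (hρ0 : 0 ≤ ρ) (hρ1 : ρ ≤ 1)
    (c : Fin (d + 1) → MonoIndex k (nkd k d + 1) ⊕ Unit → ℝ)
    (b : Fin (d + 1) → MonoIndex k (nkd k d + 1) ⊕ Unit → Fin (d + 1) → ℝ)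
    (hc : ∀ i s, |c i s| ≤ ρ ^ termDegree s) (hb : ∀ i s, ‖b i s‖ ≤ C)
    (hb' : ∀ i i' σ, b i (Sum.inl σ) = b i' (Sum.inl σ)) :
    |(Matrix.of fun i => ∑ s, c i s • b i s).det| ≤
      Fintype.card (Fin (d + 1) → MonoIndex k (nkd k d + 1) ⊕ Unit) *
        ((d + 1).factorial * C ^ (d + 1)) * ρ ^ Nkd k d := by
  classical
  have hC : 0 ≤ C := (norm_nonneg _).trans (hb 0 (Sum.inr ()))
  -- Multilinearity in the rows: `r` records which Taylor term is taken from each row.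
  have e : (Matrix.of fun i => ∑ s, c i s • b i s).det =
      ∑ r : Fin (d + 1) → MonoIndex k (nkd k d + 1) ⊕ Unit,
        (∏ i, c i (r i)) * (Matrix.of fun i => b i (r i)).det := by
    have := (Matrix.detRowAlternating (n := Fin (d + 1)) (R := ℝ)).toMultilinearMap.map_sum
      (fun i s => c i s • b i s)
    refine this.trans (Finset.sum_congr rfl fun r _ => ?_)
    exact MultilinearMap.map_smul_univ _ _ _
  rw [e, mul_assoc]
  refine (Finset.abs_sum_le_sum_abs _ _).trans ?_
  rw [← nsmul_eq_mul]
  refine Finset.sum_le_card_nsmul _ _ _ fun r _ => ?_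
  by_cases hr : ∀ i i' σ, r i = Sum.inl σ → r i' = Sum.inl σ → i = i'
  · rw [abs_mul, mul_comm]
    have h1 : |∏ i, c i (r i)| ≤ ρ ^ Nkd k d := by
      rw [Finset.abs_prod]
      calc ∏ i, |c i (r i)| ≤ ∏ i, ρ ^ termDegree (r i) :=
            Finset.prod_le_prod (fun _ _ => abs_nonneg _) fun i _ => hc i _
        _ = ρ ^ ∑ i, termDegree (r i) := Finset.prod_pow_eq_pow_sum _ _ _
        _ ≤ ρ ^ Nkd k d := pow_le_pow_of_le_one hρ0 hρ1
          (le_sum_termDegree hk (brkSum_nkd_le k d) r hr)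
    have h2 : |(Matrix.of fun i => b i (r i)).det| ≤ (d + 1).factorial * C ^ (d + 1) := by
      have := Matrix.det_le (A := Matrix.of fun i => b i (r i)) (abv := AbsoluteValue.abs) (x := C)
        fun i j => (norm_le_pi_norm (b i (r i)) j).trans (hb i _)
      simpa using this
    gcongr
  · push Not at hr
    obtain ⟨i, i', σ, hi, hi', hne⟩ := hr
    have : (Matrix.of fun i => b i (r i)).det = 0 := by
      refine Matrix.det_zero_of_row_eq hne ?_
      change b i (r i) = b i' (r i')
      rw [hi, hi', hb' i i']
    rw [this, mul_zero, abs_zero]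
    positivity

/-- Determinants formed by `d + 1` values of a smooth map on a ball of radius `ρ` are
`O (ρ ^ N_{k,d})`. -/
theorem exists_abs_det_le {k d : ℕ} (hk : 1 ≤ k) {f : (Fin k → ℝ) → Fin (d + 1) → ℝ}
    (hf : ContDiff ℝ ∞ f) (v : Fin k → ℝ) :
    ∃ C, 0 < C ∧ ∀ a ∈ Metric.closedBall v 1, ∀ ρ, 0 < ρ → ρ ≤ 1 →
      ∀ u : Fin (d + 1) → Fin k → ℝ, (∀ i, u i ∈ Metric.closedBall a ρ) →
        |(Matrix.of fun i => f (u i)).det| ≤ C * ρ ^ Nkd k d := by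
  obtain ⟨C₁, hC₁, hT⟩ := exists_taylorCoeff_bound hf v (nkd k d)
  have hcont : Continuous fun x => ∑ σ : MonoIndex k (nkd k d + 1), ‖taylorCoeff f x σ‖ :=
    continuous_finsetSum _ fun σ _ => (continuous_taylorCoeff hf σ).norm
  obtain ⟨C₂, hC₂⟩ := ((isCompact_closedBall v 1).image hcont).bddAbove
  rw [mem_upperBounds, forall_mem_image] at hC₂
  obtain ⟨C, hC₁', hC₂'⟩ : ∃ C, C₁ ≤ C ∧ C₂ ≤ C := ⟨_, le_max_left _ _, le_max_right _ _⟩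
  have hC0 : 0 ≤ C := hC₁.trans hC₁'
  -- The summand `1` only makes the constant positive when `C = 0`.
  refine ⟨(Fintype.card (Fin (d + 1) → MonoIndex k (nkd k d + 1) ⊕ Unit) : ℝ) *
        ((d + 1).factorial * C ^ (d + 1)) + 1,
    add_pos_of_nonneg_of_pos (mul_nonneg (Nat.cast_nonneg _) (mul_nonneg (Nat.cast_nonneg _)
      (pow_nonneg hC0 _))) one_pos, fun a ha ρ hρ0 hρ1 u hu => ?_⟩
  have hh : ∀ i, ‖u i - a‖ ≤ ρ := fun i => by
    simpa [dist_eq_norm] using hu i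
  set R : Fin (d + 1) → Fin (d + 1) → ℝ := fun i =>
    f (a + (u i - a)) - ∑ σ : MonoIndex k (nkd k d + 1), monoVal σ (u i - a) • taylorCoeff f a σ
  have hR : ∀ i, ‖R i‖ ≤ C * ρ ^ (nkd k d + 1) := fun i => by
    refine (hT a ha (u i - a) ((hh i).trans hρ1)).trans ?_
    have := hh i
    gcongr
  -- The remainder is treated as one more term of degree `n_{k,d} + 1`: after division by `ρ ^
  -- (n_{k,d} + 1)` its vector is bounded by `C`, but it depends on the row.
  have key := abs_det_sum_le hk hρ0.le hρ1 (C := C)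
    (fun i => Sum.elim (fun σ => monoVal σ (u i - a)) fun _ => ρ ^ (nkd k d + 1))
    (fun i => Sum.elim (fun σ => taylorCoeff f a σ) fun _ => (ρ ^ (nkd k d + 1))⁻¹ • R i)
    (by
      rintro i (σ | _)
      · exact abs_monoVal_le σ (hh i)
      · exact (abs_of_pos (pow_pos hρ0 _)).le)
    (by
      rintro i (σ | _)
      · exact (Finset.single_le_sum (f := fun σ => ‖taylorCoeff f a σ‖)
          (fun _ _ => norm_nonneg _) (Finset.mem_univ σ)).trans ((hC₂ ha).trans hC₂')
      · simp only [Sum.elim_inr]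
        rw [norm_smul, norm_inv, Real.norm_of_nonneg (by positivity), inv_mul_le_iff₀ (by positivity),
          mul_comm]
        exact hR i)
    (fun i i' σ => rfl)
  have e : (fun i => ∑ s, (Sum.elim (fun σ => monoVal σ (u i - a)) fun _ => ρ ^ (nkd k d + 1) :
      MonoIndex k (nkd k d + 1) ⊕ Unit → ℝ) s • (Sum.elim (fun σ => taylorCoeff f a σ)
        fun _ => (ρ ^ (nkd k d + 1))⁻¹ • R i : MonoIndex k (nkd k d + 1) ⊕ Unit → _) s) =
      fun i => f (u i) := by
    funext i
    rw [Fintype.sum_sum_type]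
    simp only [Sum.elim_inl, Sum.elim_inr, Finset.univ_unique, Finset.sum_singleton]
    rw [smul_smul, mul_inv_cancel₀ (by positivity), one_smul]
    simp only [R]
    rw [add_sub_cancel, add_sub_cancel]
  rw [e] at key
  refine key.trans ?_
  gcongr
  linarith

/-! ### Rational points of small height lie in a hyperplane -/

theorem height_spec {d : ℕ} {x : Fin d → ℝ} (hx : x ∈ ratPoints d) :
    0 < height x ∧ ∃ p : Fin d → ℤ, ∀ i, x i = (p i : ℝ) / (height x : ℝ) := by
  have hne : {q : ℕ | 0 < q ∧ ∃ p : Fin d → ℤ, ∀ i, x i = (p i : ℝ) / (q : ℝ)}.Nonempty := by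
    obtain ⟨r, hr⟩ := hx
    -- The product of the coordinate denominators is a common denominator, which suffices for
    -- nonemptiness.
    refine ⟨∏ i, (r i).den, Finset.prod_pos fun i _ => (r i).pos, ?_⟩
    have h : ∀ i, ∃ p : ℤ, x i = (p : ℝ) / ((∏ i, (r i).den : ℕ) : ℝ) := by
      intro i
      obtain ⟨c, hc⟩ := Finset.dvd_prod_of_mem (fun i => (r i).den) (Finset.mem_univ i)
      have hc0 : c ≠ 0 := by
        rintro rfl
        exact (Finset.prod_pos (s := Finset.univ) fun i _ => (r i).pos).ne' (by simpa using hc)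
      refine ⟨(r i).num * c, ?_⟩
      rw [hr i, hc]
      push_cast
      have h1 : ((r i).den : ℝ) ≠ 0 := by exact_mod_cast (r i).den_nz
      have h2 : (c : ℝ) ≠ 0 := by exact_mod_cast hc0
      rw [mul_div_mul_right _ _ h2]
      exact_mod_cast (Rat.num_div_den (r i)).symm
    choose p hp using h
    exact ⟨p, hp⟩
  exact Nat.sInf_mem hne

/-- The determinant formed by `d + 1` rational points of `ℝ^d` vanishes if it is small. -/
theorem det_cons_eq_zero {d : ℕ} {x : Fin (d + 1) → Fin d → ℝ} (hx : ∀ i, x i ∈ ratPoints d)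
    (hdet : ∀ i, (height (x i) : ℝ) ^ (d + 1) *
      |(Matrix.of fun i => (Fin.cons 1 (x i) : Fin (d + 1) → ℝ)).det| < 1) :
    (Matrix.of fun i => (Fin.cons 1 (x i) : Fin (d + 1) → ℝ)).det = 0 := by
  set A : Matrix (Fin (d + 1)) (Fin (d + 1)) ℝ :=
    Matrix.of fun i => (Fin.cons 1 (x i) : Fin (d + 1) → ℝ) with hA
  choose hpos p hp using fun i => height_spec (hx i)
  set P : Matrix (Fin (d + 1)) (Fin (d + 1)) ℤ :=
    Matrix.of fun i => (Fin.cons (height (x i) : ℤ) (p i) : Fin (d + 1) → ℤ) with hP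
  have hpos' : ∀ i, (0 : ℝ) < height (x i) := fun i => by exact_mod_cast hpos i
  -- Scaling each row by its height turns the matrix into an integer one, so a nonzero determinant
  -- would be at least `1` after scaling.
  have hdetP : (P.det : ℝ) = (∏ i, (height (x i) : ℝ)) * A.det := by
    rw [← Matrix.det_mul_column, ← eq_intCast (Int.castRingHom ℝ), RingHom.map_det]
    congr 1
    ext i j
    refine Fin.cases ?_ (fun j => ?_) j
    · simp [hA, hP]
    · simp only [hA, hP, RingHom.mapMatrix_apply, Matrix.map_apply, Matrix.of_apply, Fin.cons_succ,
        hp i j, eq_intCast]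
      have := (hpos' i).ne'
      field_simp
  by_contra hne
  have hP0 : P.det ≠ 0 := by
    intro h
    rw [h, Int.cast_zero] at hdetP
    exact mul_ne_zero (Finset.prod_ne_zero_iff.2 fun i _ => (hpos' i).ne') hne hdetP.symm
  have h1 : (1 : ℝ) ≤ (∏ i, (height (x i) : ℝ)) * |A.det| := by
    have : (1 : ℝ) ≤ |(P.det : ℝ)| := by exact_mod_cast Int.one_le_abs hP0
    rwa [hdetP, abs_mul, abs_of_pos (Finset.prod_pos fun i _ => hpos' i)] at this
  have hA0 : 0 < |A.det| := abs_pos.2 hne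
  -- The hypothesis for the point of largest height controls the product of all heights.
  obtain ⟨i₀, -, hi₀⟩ := Finset.exists_max_image Finset.univ (fun i => height (x i))
    Finset.univ_nonempty
  have h2 : (∏ i, (height (x i) : ℝ)) ≤ (height (x i₀) : ℝ) ^ (d + 1) := by
    calc _ ≤ ∏ _i : Fin (d + 1), (height (x i₀) : ℝ) :=
          Finset.prod_le_prod (fun i _ => (hpos' i).le) fun i hi => by exact_mod_cast hi₀ i hi
      _ = _ := by simp
  exact absurd (hdet i₀) (not_lt.2 (h1.trans (by gcongr)))

/-- A set of vectors all of whose determinants vanish lies in a hyperplane. -/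
theorem exists_functional_of_det_eq_zero {n : ℕ} {S : Set (Fin n → ℝ)}
    (hS : ∀ w : Fin n → Fin n → ℝ, (∀ i, w i ∈ S) → (Matrix.of w).det = 0) :
    ∃ l : (Fin n → ℝ) →L[ℝ] ℝ, l ≠ 0 ∧ ∀ w ∈ S, l w = 0 := by
  have hlt : Submodule.span ℝ S < ⊤ := by
    refine lt_top_iff_ne_top.2 fun htop => ?_
    have hcard : Module.finrank ℝ (Submodule.span ℝ S) = n := by
      rw [htop, finrank_top, Module.finrank_fin_fun]
    have hex := Submodule.exists_fun_fin_finrank_span_eq ℝ S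
    rw [hcard] at hex
    obtain ⟨w, hwS, -, hw⟩ := hex
    have hu : IsUnit (Matrix.of w) := Matrix.linearIndependent_rows_iff_isUnit.1 hw
    exact ((Matrix.isUnit_iff_isUnit_det _).1 hu).ne_zero (hS w hwS)
  obtain ⟨l, hl, hle⟩ := Submodule.exists_le_ker_of_lt_top _ hlt
  refine ⟨LinearMap.toContinuousLinearMap l, by simpa using hl, fun w hw => ?_⟩
  exact hle (Submodule.subset_span hw)

/-! ### Zero sets of nondegenerate functions are uniformly porous -/

/-- Distinct indices give distinct exponent vectors, and a polynomial vanishing on a product of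
infinite sets has zero coefficients. -/
theorem eq_zero_of_sum_monoVal_eq_zero {k n : ℕ} {α : MonoIndex k n → ℝ}
    (h : ∀ y ∈ Metric.closedBall (0 : Fin k → ℝ) (1 / 2), ∑ σ, α σ * monoVal σ y = 0) : α = 0 := by
  classical
  have hinj : Function.Injective fun σ : MonoIndex k n =>
      Multiset.toFinsupp (σ.2 : Multiset (Fin k)) := by
    rintro ⟨j, σ⟩ ⟨j', σ'⟩ hσ
    have h1 : (σ : Multiset (Fin k)) = σ' := Multiset.toFinsupp.injective hσ
    have h2 : j = j' := by
      have := congrArg Multiset.card h1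
      simp only [Sym.card_coe] at this
      exact Fin.ext this
    subst h2
    rw [Sym.coe_inj.1 h1]
  set P : MvPolynomial (Fin k) ℝ :=
    ∑ σ, MvPolynomial.monomial (Multiset.toFinsupp (σ.2 : Multiset (Fin k))) (α σ) with hP
  have heval : ∀ y, MvPolynomial.eval y P = ∑ σ, α σ * monoVal σ y := by
    intro y
    rw [hP, map_sum]
    refine Finset.sum_congr rfl fun σ _ => ?_
    rw [MvPolynomial.eval_monomial, monoVal, Finsupp.prod, Multiset.toFinsupp_support,
      Finset.prod_multiset_map_count]
    simp only [Multiset.toFinsupp_apply]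
  have hP0 : P = 0 := by
    refine MvPolynomial.funext_set (fun _ => Icc (-(1 / 2) : ℝ) (1 / 2))
      (fun _ => Icc_infinite (by norm_num)) fun y hy => ?_
    rw [heval, map_zero]
    apply h
    rw [mem_closedBall_zero_iff, pi_norm_le_iff_of_nonneg (by norm_num)]
    exact fun i => abs_le.2 (hy i trivial)
  funext σ
  have := congrArg (MvPolynomial.coeff (Multiset.toFinsupp (σ.2 : Multiset (Fin k)))) hP0
  rw [hP, MvPolynomial.coeff_sum, MvPolynomial.coeff_zero, Finset.sum_eq_single σ] at this
  · simpa using this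
  · intro τ _ hτ
    rw [MvPolynomial.coeff_monomial, if_neg fun h => hτ (hinj h)]
  · simp

/-- A polynomial is large, compared with its coefficients, on some ball of fixed size. -/
theorem exists_polynomial_large (k n : ℕ) : ∃ c δ : ℝ, 0 < c ∧ 0 < δ ∧ δ ≤ 1 / 2 ∧
    ∀ α : MonoIndex k n → ℝ, ∃ y ∈ Metric.closedBall (0 : Fin k → ℝ) (1 / 2),
      ∀ y' ∈ Metric.closedBall y δ, c * ‖α‖ ≤ |∑ σ, α σ * monoVal σ y'| := by
  set K : Set (Fin k → ℝ) := Metric.closedBall 0 (1 / 2) with hK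
  have hKc : IsCompact K := isCompact_closedBall _ _
  have : CompactSpace K := isCompact_iff_compactSpace.1 hKc
  have hcont : ∀ α : MonoIndex k n → ℝ, Continuous fun y => ∑ σ, α σ * monoVal σ y :=
    fun α => continuous_finsetSum _ fun σ _ => continuous_const.mul (continuous_monoVal σ)
  set T : (MonoIndex k n → ℝ) →ₗ[ℝ] C(K, ℝ) :=
    { toFun := fun α => ⟨fun y => ∑ σ, α σ * monoVal σ y,
        (hcont α).comp continuous_subtype_val⟩
      map_add' := fun α β => by
        ext y
        simp [add_mul, Finset.sum_add_distrib]
      map_smul' := fun a α => by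
        ext y
        simp [Finset.mul_sum, mul_assoc] } with hT
  have hker : T.ker = ⊥ := by
    refine LinearMap.ker_eq_bot'.2 fun α hα => eq_zero_of_sum_monoVal_eq_zero fun y hy => ?_
    exact DFunLike.congr_fun hα (⟨y, hy⟩ : K)
  -- An injective linear map from a finite-dimensional space is bounded below: the sup norm on `K`
  -- dominates the coefficients.
  obtain ⟨A, hA0, hA⟩ := T.exists_antilipschitzWith hker
  have hA0' : (0 : ℝ) < A := hA0
  set S : ℝ := ((Fintype.card (MonoIndex k n) : ℕ) : ℝ) with hS
  have hS0 : 0 ≤ S := Nat.cast_nonneg _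
  have huc : UniformContinuousOn (fun y (σ : MonoIndex k n) => monoVal σ y)
      (Metric.closedBall (0 : Fin k → ℝ) 1) :=
    (isCompact_closedBall _ _).uniformContinuousOn_of_continuous
      (continuous_pi fun σ => continuous_monoVal σ).continuousOn
  -- With this tolerance, moving by less than `δ` from the maximum costs at most half of the lower
  -- bound `‖α‖ / A`; `S + 1` guards against `S = 0`.
  obtain ⟨δ, hδ0, hδ⟩ := Metric.uniformContinuousOn_iff.1 huc (1 / (2 * A * (S + 1)))
    (by positivity)
  refine ⟨1 / (2 * A), min (δ / 2) (1 / 2), by positivity, by positivity, min_le_right _ _,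
    fun α => ?_⟩
  obtain ⟨y, hyK, hy⟩ := hKc.exists_isMaxOn ⟨0, by simp [hK]⟩ (hcont α).abs.continuousOn
  refine ⟨y, hyK, fun y' hy' => ?_⟩
  have h1 : ‖α‖ ≤ A * |∑ σ, α σ * monoVal σ y| := by
    have h2 := hA.le_mul_dist α 0
    rw [dist_zero_right, map_zero, dist_zero_right] at h2
    refine h2.trans ?_
    gcongr
    refine (ContinuousMap.norm_le _ (abs_nonneg _)).2 fun z => ?_
    exact hy z.2
  rw [Metric.mem_closedBall] at hy'
  have hy1 : y ∈ Metric.closedBall (0 : Fin k → ℝ) 1 :=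
    Metric.closedBall_subset_closedBall (by norm_num) hyK
  have hy1' : y' ∈ Metric.closedBall (0 : Fin k → ℝ) 1 := by
    rw [hK, Metric.mem_closedBall] at hyK
    rw [Metric.mem_closedBall]
    have := dist_triangle y' y 0
    have := min_le_right (δ / 2) (1 / 2)
    linarith
  have h3 : ∀ σ : MonoIndex k n, |monoVal σ y - monoVal σ y'| ≤ 1 / (2 * A * (S + 1)) := fun σ => by
    have := hδ y hy1 y' hy1' (by
      rw [dist_comm]
      have := min_le_left (δ / 2) (1 / 2)
      linarith)
    exact (dist_le_pi_dist (fun σ : MonoIndex k n => monoVal σ y) (fun σ => monoVal σ y') σ).trans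
      this.le
  have h4 : |∑ σ, α σ * monoVal σ y| - |∑ σ, α σ * monoVal σ y'| ≤ 1 / (2 * A) * ‖α‖ := by
    refine (abs_sub_abs_le_abs_sub _ _).trans ?_
    rw [← Finset.sum_sub_distrib]
    refine (Finset.abs_sum_le_sum_abs _ _).trans ?_
    calc ∑ σ, |α σ * monoVal σ y - α σ * monoVal σ y'|
        ≤ ∑ _σ : MonoIndex k n, ‖α‖ * (1 / (2 * A * (S + 1))) :=
          Finset.sum_le_sum fun σ _ => by
            rw [← mul_sub, abs_mul]
            exact mul_le_mul (norm_le_pi_norm α σ) (h3 σ) (abs_nonneg _) (norm_nonneg _)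
      _ = 1 / (2 * A) * ‖α‖ * (S / (S + 1)) := by
          rw [Finset.sum_const, Finset.card_univ, nsmul_eq_mul, ← hS]
          field_simp
      _ ≤ 1 / (2 * A) * ‖α‖ * 1 := by
          gcongr
          rw [div_le_one (by positivity)]
          linarith
      _ = _ := mul_one _
  have h5 : 1 / A * ‖α‖ ≤ |∑ σ, α σ * monoVal σ y| := by
    rw [one_div, inv_mul_le_iff₀ hA0']
    exact h1
  have h6 : 1 / A * ‖α‖ = 1 / (2 * A) * ‖α‖ + 1 / (2 * A) * ‖α‖ := by
    field_simp
    norm_num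
  linarith

/-- If the Taylor coefficients of `f` at `v` of order at most `n` span the target space, then the
zero sets of `l ∘ f`, where `l` is a nonzero functional, are porous near `v`, uniformly in `l`. -/
theorem exists_porous {k n : ℕ} {F : Type*} [NormedAddCommGroup F] [NormedSpace ℝ F]
    [FiniteDimensional ℝ F] {f : (Fin k → ℝ) → F} (hf : ContDiff ℝ ∞ f) (v : Fin k → ℝ)
    (hspan : ∀ l : F →L[ℝ] ℝ,
      (∀ σ : MonoIndex k (n + 1), l (taylorCoeff f v σ) = 0) → l = 0) :
    ∃ δ r : ℝ, 0 < δ ∧ δ ≤ 1 / 2 ∧ 0 < r ∧ r ≤ 1 / 2 ∧ ∀ a ∈ Metric.closedBall v r, ∀ ρ, 0 < ρ →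
      ρ ≤ r → ∀ l : F →L[ℝ] ℝ, l ≠ 0 → ∃ x,
        Metric.closedBall x (δ * ρ) ⊆ Metric.closedBall a ρ ∧
        ∀ u ∈ Metric.closedBall x (δ * ρ), l (f u) ≠ 0 := by
  obtain ⟨c, δ, hc, hδ0, hδ1, hpoly⟩ := exists_polynomial_large k (n + 1)
  obtain ⟨C, hC0, hC⟩ := exists_taylorCoeff_bound hf v n
  set T : (F →L[ℝ] ℝ) →ₗ[ℝ] (MonoIndex k (n + 1) → ℝ) :=
    { toFun := fun l σ => l (taylorCoeff f v σ)
      map_add' := fun _ _ => rfl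
      map_smul' := fun _ _ => rfl } with hT
  have hker : T.ker = ⊥ := LinearMap.ker_eq_bot'.2 fun l hl => hspan l fun σ => congrFun hl σ
  obtain ⟨A, hA0, hA⟩ := T.exists_antilipschitzWith hker
  have hA0' : (0 : ℝ) < A := hA0
  -- The lower bound on `l` through its values on Taylor coefficients survives at nearby base points
  -- with half the constant, uniformly in `l`.
  have hnear : ∀ᶠ a in 𝓝 v, ∀ σ : MonoIndex k (n + 1),
      dist (taylorCoeff f a σ) (taylorCoeff f v σ) < 1 / (2 * A) := by
    refine eventually_all.2 fun σ => ?_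
    exact (continuous_taylorCoeff hf σ).continuousAt.eventually
      (Metric.ball_mem_nhds _ (by positivity))
  obtain ⟨r₀, hr₀, hnear⟩ := Metric.nhds_basis_closedBall.eventually_iff.1 hnear
  have hcoef : ∀ a ∈ Metric.closedBall v r₀, ∀ l : F →L[ℝ] ℝ,
      ‖l‖ / (2 * A) ≤ ‖fun σ : MonoIndex k (n + 1) => l (taylorCoeff f a σ)‖ := by
    intro a ha l
    have h1 := hA.le_mul_dist l 0
    rw [dist_zero_right, map_zero, dist_zero_right] at h1
    have h2 : ‖T l - fun σ => l (taylorCoeff f a σ)‖ ≤ ‖l‖ * (1 / (2 * A)) := by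
      refine (pi_norm_le_iff_of_nonneg (by positivity)).2 fun σ => ?_
      change ‖l (taylorCoeff f v σ) - l (taylorCoeff f a σ)‖ ≤ _
      rw [← map_sub]
      refine (l.le_opNorm _).trans ?_
      gcongr
      rw [← dist_eq_norm, dist_comm]
      exact (hnear ha σ).le
    have h3 := norm_sub_norm_le (T l) fun σ => l (taylorCoeff f a σ)
    have h4 : ‖l‖ / A ≤ ‖T l‖ := by
      rw [div_le_iff₀ hA0', mul_comm]
      exact h1
    have h5 : ‖l‖ / A = ‖l‖ / (2 * A) + ‖l‖ * (1 / (2 * A)) := by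
      field_simp
      norm_num
    linarith
  refine ⟨δ, min (min r₀ (1 / 2)) (c / (4 * A * (C + 1))), hδ0, hδ1, by positivity,
    (min_le_left _ _).trans (min_le_right _ _), fun a ha ρ hρ0 hρr l hl => ?_⟩
  have hρ1 : ρ ≤ 1 / 2 := hρr.trans ((min_le_left _ _).trans (min_le_right _ _))
  have hρC : ρ * C ≤ c / (4 * A) := by
    have h1 : ρ ≤ c / (4 * A * (C + 1)) := hρr.trans (min_le_right _ _)
    calc ρ * C ≤ ρ * (C + 1) := by nlinarith
      _ ≤ c / (4 * A * (C + 1)) * (C + 1) := by gcongr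
      _ = c / (4 * A) := by field_simp
  have har : a ∈ Metric.closedBall v r₀ :=
    Metric.closedBall_subset_closedBall ((min_le_left _ _).trans (min_le_left _ _)) ha
  have ha1 : a ∈ Metric.closedBall v 1 := Metric.closedBall_subset_closedBall
    (((min_le_left _ _).trans (min_le_right _ _)).trans (by norm_num)) ha
  -- These are the coefficients, in the rescaled variable `z`, of the Taylor polynomial of `l ∘ f`
  -- at `a + ρ • z`.
  set α : MonoIndex k (n + 1) → ℝ := fun σ => ρ ^ (σ.1 : ℕ) * l (taylorCoeff f a σ) with hα
  have hαn : ρ ^ n * (‖l‖ / (2 * A)) ≤ ‖α‖ := by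
    refine (mul_le_mul_of_nonneg_left (hcoef a har l) (by positivity)).trans ?_
    rw [← Real.norm_of_nonneg (pow_nonneg hρ0.le n), ← norm_smul]
    refine (pi_norm_le_iff_of_nonneg (norm_nonneg _)).2 fun σ => ?_
    refine le_trans ?_ (norm_le_pi_norm α σ)
    simp only [Pi.smul_apply, smul_eq_mul, hα, norm_mul]
    gcongr
    rw [Real.norm_of_nonneg (pow_nonneg hρ0.le n), Real.norm_of_nonneg (by positivity)]
    exact pow_le_pow_of_le_one hρ0.le (by linarith) (Nat.lt_succ_iff.1 σ.1.2)
  obtain ⟨y, hy, hy'⟩ := hpoly α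
  rw [mem_closedBall_zero_iff] at hy
  refine ⟨a + ρ • y, ?_, fun u hu => ?_⟩
  · apply Metric.closedBall_subset_closedBall'
    rw [dist_eq_norm, add_sub_cancel_left, norm_smul, Real.norm_of_nonneg hρ0.le]
    nlinarith
  · obtain ⟨z, rfl⟩ : ∃ z, u = a + ρ • z :=
      ⟨ρ⁻¹ • (u - a), by rw [smul_smul, mul_inv_cancel₀ hρ0.ne', one_smul, add_sub_cancel]⟩
    have hz : z ∈ Metric.closedBall y δ := by
      rw [Metric.mem_closedBall, dist_add_left, dist_smul₀, Real.norm_of_nonneg hρ0.le,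
        mul_comm] at hu
      exact le_of_mul_le_mul_right hu hρ0
    have hz1 : ‖z‖ ≤ 1 := by
      have h1 : ‖z - y‖ ≤ δ := by rwa [← dist_eq_norm]
      have h2 := norm_le_norm_add_norm_sub' z y
      linarith
    have hρz : ‖ρ • z‖ ≤ ρ := by
      rw [norm_smul, Real.norm_of_nonneg hρ0.le]
      exact mul_le_of_le_one_right hρ0.le hz1
    have h1 := hC a ha1 (ρ • z) (by linarith)
    have h2 : |l (f (a + ρ • z)) - ∑ σ, α σ * monoVal σ z| ≤ ‖l‖ * (C * ρ ^ (n + 1)) := by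
      have e : ∑ σ, α σ * monoVal σ z =
          l (∑ σ : MonoIndex k (n + 1), monoVal σ (ρ • z) • taylorCoeff f a σ) := by
        rw [map_sum]
        refine Finset.sum_congr rfl fun σ _ => ?_
        rw [map_smul, monoVal_smul, smul_eq_mul]
        ring
      rw [e, ← map_sub]
      refine (l.le_opNorm _).trans ?_
      gcongr
      refine h1.trans ?_
      gcongr
    have h3 := hy' z hz
    intro h0
    rw [h0, zero_sub, abs_neg] at h2
    have hl0 : 0 < ‖l‖ := norm_pos_iff.2 hl
    -- A zero would force the main term of order `ρ ^ n` below the remainder of order `ρ ^ (n + 1)`,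
    -- which the choice of the radius keeps at most half as large.
    have h4 : c * (ρ ^ n * (‖l‖ / (2 * A))) ≤ ‖l‖ * (C * ρ ^ (n + 1)) :=
      (mul_le_mul_of_nonneg_left hαn hc.le).trans (h3.trans h2)
    have h5 : ‖l‖ * (C * ρ ^ (n + 1)) ≤ ‖l‖ * ρ ^ n * (c / (4 * A)) := by
      calc ‖l‖ * (C * ρ ^ (n + 1)) = ‖l‖ * ρ ^ n * (ρ * C) := by ring
        _ ≤ _ := by gcongr
    have h6 : c * (ρ ^ n * (‖l‖ / (2 * A))) = 2 * (‖l‖ * ρ ^ n * (c / (4 * A))) := by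
      field_simp
      norm_num
    have h7 : 0 < ‖l‖ * ρ ^ n * (c / (4 * A)) := by positivity
    linarith

/-! ### Local parametrizations -/

/-- Near a point, a map that is smooth on an open set agrees with a globally smooth map. -/
theorem exists_contDiff_eventuallyEq {E F : Type*} [NormedAddCommGroup E] [NormedSpace ℝ E]
    [FiniteDimensional ℝ E] [NormedAddCommGroup F] [NormedSpace ℝ F] {f : E → F} {U : Set E}
    (hU : IsOpen U) (hf : ContDiffOn ℝ ∞ f U) {v : E} (hv : v ∈ U) :
    ∃ g : E → F, ContDiff ℝ ∞ g ∧ g =ᶠ[𝓝 v] f := by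
  obtain ⟨R, hR, hRU⟩ := Metric.nhds_basis_closedBall.mem_iff.1 (hU.mem_nhds hv)
  let χ : ContDiffBump v := ⟨R / 2, R, by positivity, by linarith⟩
  refine ⟨fun x => χ x • f x, contDiff_iff_contDiffAt.2 fun x => ?_, ?_⟩
  · by_cases hx : x ∈ U
    · exact χ.contDiff.contDiffAt.smul (hf.contDiffAt (hU.mem_nhds hx))
    -- Outside `U` nothing is known about `f`, but the cutoff vanishes near such points.
    · have hx' : x ∉ tsupport χ := fun h => hx (hRU (by rwa [χ.tsupport_eq] at h))
      have h0 : (fun x => χ x • f x) =ᶠ[𝓝 x] fun _ => (0 : F) := by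
        filter_upwards [notMem_tsupport_iff_eventuallyEq.1 hx'] with y hy
        rw [hy, Pi.zero_apply, zero_smul]
      exact contDiffAt_const.congr_of_eventuallyEq h0
  · filter_upwards [Metric.closedBall_mem_nhds v χ.rIn_pos] with y hy
    rw [χ.one_of_mem_closedBall hy, one_smul]

/-- A smooth map is expanding near a point at which its derivative is injective. -/
theorem exists_mul_dist_le_dist {E F : Type*} [NormedAddCommGroup E] [NormedSpace ℝ E]
    [FiniteDimensional ℝ E] [NormedAddCommGroup F] [NormedSpace ℝ F] {f : E → F}
    (hf : ContDiff ℝ ∞ f) {v : E} (hinj : Function.Injective (fderiv ℝ f v)) :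
    ∃ c r : ℝ, 0 < c ∧ 0 < r ∧ ∀ x ∈ Metric.closedBall v r, ∀ y ∈ Metric.closedBall v r,
      c * dist x y ≤ dist (f x) (f y) := by
  obtain ⟨A, hA0, hA⟩ := (fderiv ℝ f v : E →ₗ[ℝ] F).exists_antilipschitzWith
    (LinearMap.ker_eq_bot.2 hinj)
  have hA0' : (0 : ℝ) < A := hA0
  have hs := (hf.contDiffAt (x := v)).hasStrictFDerivAt (by simp)
  -- Strict differentiability compares two moving points; the error is kept to half the lower bound
  -- of the derivative.
  have hlo := hs.isLittleO.def (c := 1 / (2 * A)) (by positivity)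
  rw [nhds_prod_eq, Metric.nhds_basis_closedBall.prod_self.eventually_iff] at hlo
  obtain ⟨r, hr, h⟩ := hlo
  refine ⟨1 / (2 * A), r, by positivity, hr, fun x hx y hy => ?_⟩
  have h1 := h (mk_mem_prod hx hy)
  simp only at h1
  have h2 := hA.le_mul_dist (x - y) 0
  rw [dist_zero_right, map_zero, dist_zero_right] at h2
  have h3 : ‖x - y‖ / A ≤ ‖fderiv ℝ f v (x - y)‖ := by
    rw [div_le_iff₀ hA0', mul_comm]
    exact h2
  have h4 := norm_sub_norm_le (fderiv ℝ f v (x - y)) (f x - f y)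
  rw [norm_sub_rev (fderiv ℝ f v (x - y)) (f x - f y)] at h4
  have h5 : ‖x - y‖ / A = 1 / (2 * A) * ‖x - y‖ + 1 / (2 * A) * ‖x - y‖ := by
    field_simp
    norm_num
  rw [dist_eq_norm, dist_eq_norm]
  linarith

theorem osculatingSpace_congr {k d : ℕ} {Ψ Φ : (Fin k → ℝ) → Fin d → ℝ} {v : Fin k → ℝ}
    (h : Ψ =ᶠ[𝓝 v] Φ) (D : ℕ) : osculatingSpace Ψ v D = osculatingSpace Φ v D := by
  have e : ∀ i, iteratedFDeriv ℝ i Ψ v = iteratedFDeriv ℝ i Φ v := fun i =>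
    (EventuallyEq.iteratedFDeriv ℝ h i).eq_of_nhds
  simp only [osculatingSpace, e]

/-- The linear embedding of `ℝ^d` into `ℝ^(d+1)` as the vectors with first coordinate `0`. -/
noncomputable def consZero (d : ℕ) : (Fin d → ℝ) →L[ℝ] (Fin (d + 1) → ℝ) :=
  LinearMap.toContinuousLinearMap
    { toFun := fun y => Fin.cons 0 y
      map_add' := fun y z => by
        ext i
        refine Fin.cases ?_ (fun i => ?_) i <;> simp
      map_smul' := fun a y => by
        ext i
        refine Fin.cases ?_ (fun i => ?_) i <;> simp }

theorem consZero_apply {d : ℕ} (y : Fin d → ℝ) : consZero d y = Fin.cons 0 y := rfl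

theorem cons_eq_add_consZero {d : ℕ} (a : ℝ) (y : Fin d → ℝ) :
    (Fin.cons a y : Fin (d + 1) → ℝ) = a • Fin.cons 1 0 + consZero d y := by
  rw [consZero_apply]
  ext i
  refine Fin.cases ?_ (fun i => ?_) i <;> simp

theorem contDiff_cons_one {k d : ℕ} {Ψ : (Fin k → ℝ) → Fin d → ℝ} (hΨ : ContDiff ℝ ∞ Ψ) :
    ContDiff ℝ ∞ fun u => (Fin.cons 1 (Ψ u) : Fin (d + 1) → ℝ) := by
  have e : (fun u => (Fin.cons 1 (Ψ u) : Fin (d + 1) → ℝ)) =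
      fun u => (1 : ℝ) • Fin.cons 1 0 + consZero d (Ψ u) :=
    funext fun u => cons_eq_add_consZero 1 (Ψ u)
  rw [e]
  exact contDiff_const.add ((consZero d).contDiff.comp hΨ)

/-- If `Ψ` is nondegenerate at `v`, then the Taylor coefficients of `(1, Ψ)` at `v` span. -/
theorem eq_zero_of_taylorCoeff_eq_zero {k d D : ℕ} {Ψ : (Fin k → ℝ) → Fin d → ℝ}
    (hΨ : ContDiff ℝ ∞ Ψ) {v : Fin k → ℝ} (hosc : osculatingSpace Ψ v D = ⊤)
    (l : (Fin (d + 1) → ℝ) →L[ℝ] ℝ)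
    (hl : ∀ σ : MonoIndex k (D + 1),
      l (taylorCoeff (fun u => (Fin.cons 1 (Ψ u) : Fin (d + 1) → ℝ)) v σ) = 0) : l = 0 := by
  set f : (Fin k → ℝ) → Fin (d + 1) → ℝ := fun u => Fin.cons 1 (Ψ u) with hf
  have hfs : ContDiff ℝ ∞ f := contDiff_cons_one hΨ
  have hder : ∀ i ≤ D, ∀ s : Fin i → Fin k,
      l (iteratedFDeriv ℝ i f v fun j => Pi.single (s j) (1 : ℝ)) = 0 := by
    intro i hi s
    obtain ⟨c, hc⟩ := exists_iteratedFDeriv_eq_smul_taylorCoeff hfs v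
      (⟨i, Nat.lt_succ_of_le hi⟩ : Fin (D + 1)) s
    have hc' : (iteratedFDeriv ℝ i f v fun j => Pi.single (s j) (1 : ℝ)) = c • _ := hc
    rw [hc', map_smul, hl, smul_zero]
  have hfe : f = (fun _ => (Fin.cons 1 0 : Fin (d + 1) → ℝ)) + (consZero d ∘ Ψ) := by
    funext u
    simp only [hf, Pi.add_apply, Function.comp_apply]
    rw [cons_eq_add_consZero 1, one_smul]
  have hstep : ∀ i, i ≠ 0 → ∀ m : Fin i → Fin k → ℝ,
      iteratedFDeriv ℝ i f v m = consZero d (iteratedFDeriv ℝ i Ψ v m) := by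
    intro i hi m
    rw [hfe, iteratedFDeriv_add_apply contDiffAt_const
      (((consZero d).contDiff.comp hΨ).contDiffAt.of_le (by exact_mod_cast le_top)),
      iteratedFDeriv_const_of_ne hi,
      (consZero d).iteratedFDeriv_comp_left hΨ.contDiffAt (i := i) (by exact_mod_cast le_top)]
    simp
  -- Derivatives of positive order have first coordinate zero and span that hyperplane; the
  -- coefficient of order zero then settles the remaining direction.
  have hker : ∀ y, l (consZero d y) = 0 := by
    intro y
    have hy : y ∈ osculatingSpace Ψ v D := hosc ▸ Submodule.mem_top
    refine Submodule.span_induction (p := fun y _ => l (consZero d y) = 0) ?_ (by simp)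
      (fun a b _ _ ha hb => by rw [map_add, map_add, ha, hb, add_zero])
      (fun a b _ hb => by rw [map_smul, map_smul, hb, smul_zero]) hy
    rintro w ⟨i, hi1, hiD, s, rfl⟩
    rw [← hstep i (by omega)]
    exact hder i hiD s
  have hone : l (Fin.cons 1 0) = 0 := by
    have h0 := hder 0 (Nat.zero_le _) Fin.elim0
    rw [iteratedFDeriv_zero_apply] at h0
    simp only [hf] at h0
    rwa [cons_eq_add_consZero 1, map_add, hker, add_zero, one_smul] at h0
  ext1 w
  rw [← Fin.cons_self_tail w, cons_eq_add_consZero, map_add, hker, map_smul, hone]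
  simp

/-- Every small ball contains a ball of comparable size which misses all the parameters of
rational points of height `O (ρ ^ (-N_{k,d} / (d + 1)))`. -/
theorem exists_ball_disjoint_rational {k d D : ℕ} (hk : 1 ≤ k) {Ψ : (Fin k → ℝ) → Fin d → ℝ}
    (hΨ : ContDiff ℝ ∞ Ψ) {v : Fin k → ℝ} (hosc : osculatingSpace Ψ v D = ⊤) :
    ∃ δ r C : ℝ, 0 < δ ∧ δ ≤ 1 ∧ 0 < r ∧ 0 < C ∧ ∀ a ∈ Metric.closedBall v r, ∀ ρ, 0 < ρ →
      ρ ≤ r → ∃ x, Metric.closedBall x (δ * ρ) ⊆ Metric.closedBall a ρ ∧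
        Disjoint (Metric.closedBall x (δ * ρ))
          {u | Ψ u ∈ ratPoints d ∧ (height (Ψ u) : ℝ) ^ (d + 1) * (C * ρ ^ Nkd k d) < 1} := by
  have hfs := contDiff_cons_one hΨ
  obtain ⟨δ, r, hδ0, hδ1, hr0, hr1, hpor⟩ := exists_porous hfs v
    (eq_zero_of_taylorCoeff_eq_zero hΨ hosc)
  obtain ⟨C, hC0, hC⟩ := exists_abs_det_le hk hfs v
  refine ⟨δ, r, C, hδ0, by linarith, hr0, hC0, fun a ha ρ hρ0 hρr => ?_⟩
  obtain ⟨l, hl0, hl⟩ := exists_functional_of_det_eq_zero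
    (S := (fun u => (Fin.cons 1 (Ψ u) : Fin (d + 1) → ℝ)) '' (Metric.closedBall a ρ ∩
      {u | Ψ u ∈ ratPoints d ∧ (height (Ψ u) : ℝ) ^ (d + 1) * (C * ρ ^ Nkd k d) < 1})) (by
      intro w hw
      choose u hu huw using hw
      obtain rfl : (fun i => (Fin.cons 1 (Ψ (u i)) : Fin (d + 1) → ℝ)) = w := funext huw
      refine det_cons_eq_zero (fun i => (hu i).2.1) fun i => ?_
      refine lt_of_le_of_lt ?_ (hu i).2.2
      gcongr
      exact hC a (Metric.closedBall_subset_closedBall (by linarith) ha) ρ hρ0 (by linarith) u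
        fun i => (hu i).1)
  obtain ⟨x, hx1, hx2⟩ := hpor a ha ρ hρ0 hρr l hl0
  exact ⟨x, hx1, Set.disjoint_left.2 fun u hu hu' =>
    hx2 u hu (hl _ ⟨u, ⟨hx1 hu, hu'⟩, rfl⟩)⟩

/-! ### Dimension of the set of badly approximable points -/

/-- Taking `N`-th roots turns the failure of the smallness condition at scale `ρ` into a lower bound
for `ρ`; this produces the exponent `(d + 1) / N`. -/
theorem le_of_one_le_pow_mul {d N : ℕ} (hN : N ≠ 0) {H C ρ : ℝ} (hH : 0 < H) (hC : 0 < C)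
    (hρ : 0 ≤ ρ) (h : 1 ≤ H ^ (d + 1) * (C * ρ ^ N)) :
    C⁻¹ ^ (N : ℝ)⁻¹ * psi (((d : ℝ) + 1) / N) H ≤ ρ := by
  rw [← pow_le_pow_iff_left₀ (by unfold psi; positivity) hρ hN, mul_pow,
    Real.rpow_inv_natCast_pow (by positivity) hN, psi, div_pow, one_pow,
    ← Real.rpow_mul_natCast hH.le, div_mul_cancel₀ _ (by exact_mod_cast hN)]
  have : H ^ ((d : ℝ) + 1) = H ^ (d + 1) := by exact_mod_cast Real.rpow_natCast H (d + 1)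
  rw [this, one_div, ← mul_inv, inv_le_iff_one_le_mul₀ (by positivity)]
  linarith

/-- Each Cantor step contracts by `δ / (4 * m)` while resolving one base-`m` digit; this exponent
matches the two rates. -/
theorem rpow_log_div_log {δ m : ℝ} (hδ0 : 0 < δ) (hm : 0 < m)
    (h : Real.log m + Real.log (4 / δ) ≠ 0) :
    (δ / (4 * m)) ^ (Real.log m / (Real.log m + Real.log (4 / δ))) = m⁻¹ := by
  have e : Real.log (δ / (4 * m)) = -(Real.log m + Real.log (4 / δ)) := by
    rw [Real.log_div hδ0.ne' (by positivity), Real.log_mul (by norm_num) hm.ne',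
      Real.log_div (by norm_num) hδ0.ne']
    ring
  rw [Real.rpow_def_of_pos (by positivity), e, neg_mul, mul_div_cancel₀ _ h, Real.exp_neg,
    Real.exp_log hm]

theorem tendsto_log_div_log (c : ℝ) :
    Tendsto (fun m : ℕ => Real.log m / (Real.log m + c)) atTop (𝓝 1) := by
  have h1 : Tendsto (fun m : ℕ => Real.log m) atTop atTop :=
    Real.tendsto_log_atTop.comp tendsto_natCast_atTop_atTop
  have h2 : Tendsto (fun m : ℕ => 1 - c / (Real.log m + c)) atTop (𝓝 (1 - 0)) :=
    tendsto_const_nhds.sub (tendsto_const_nhds.div_atTop (tendsto_atTop_add_const_right _ _ h1))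
  rw [sub_zero] at h2
  refine h2.congr' ?_
  filter_upwards [h1.eventually_gt_atTop (-c)] with m hm
  have : Real.log m + c ≠ 0 := by linarith
  field_simp
  ring

theorem psi_le_one {c t : ℝ} (hc : 0 ≤ c) (ht : 1 ≤ t) : psi c t ≤ 1 := by
  rw [psi, div_le_one (by positivity)]
  exact Real.one_le_rpow ht hc

theorem psi_pos {c t : ℝ} (ht : 0 < t) : 0 < psi c t := by
  unfold psi
  positivity

theorem one_le_height {d : ℕ} {x : Fin d → ℝ} (hx : x ∈ ratPoints d) : (1 : ℝ) ≤ height x := by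
  exact_mod_cast (height_spec hx).1

theorem ckd_nonneg (k d : ℕ) : 0 ≤ ckd k d := by
  unfold ckd
  positivity

/-- A chart that is nondegenerate at a point gives subsets of `BA_M` of dimension close to `k`. -/
theorem le_dimH_BA {k d D : ℕ} (hk : 1 ≤ k) (hd : 1 ≤ d) {M : Set (Fin d → ℝ)}
    {U : Set (Fin k → ℝ)} {Ψ₀ : (Fin k → ℝ) → Fin d → ℝ} (hΨ₀ : IsLocalParametrization M U Ψ₀)
    {v : Fin k → ℝ} (hv : v ∈ U) (hosc : osculatingSpace Ψ₀ v D = ⊤) :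
    (k : ℝ≥0∞) ≤ dimH (BA M (psi (ckd k d))) := by
  obtain ⟨Ψ, hΨ, heq⟩ := exists_contDiff_eventuallyEq hΨ₀.isOpen hΨ₀.contDiffOn hv
  rw [← osculatingSpace_congr heq] at hosc
  have hinj : Function.Injective (fderiv ℝ Ψ v) := by
    rw [heq.fderiv_eq]
    exact hΨ₀.immersion v hv
  obtain ⟨c₀, r₀, hc₀, hr₀, hexp⟩ := exists_mul_dist_le_dist hΨ hinj
  obtain ⟨δ, r₁, C, hδ0, hδ1, hr₁, hC, hZ⟩ := exists_ball_disjoint_rational hk hΨ hosc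
  obtain ⟨r₂, hr₂, hr₂'⟩ := Metric.nhds_basis_closedBall.eventually_iff.1
    (heq.and (hΨ₀.isOpen.mem_nhds hv))
  -- points of `M` close to `Ψ v` have parameters close to `v`
  obtain ⟨η, hη, hclose⟩ : ∃ η : ℝ, 0 < η ∧ ∀ x ∈ M, dist x (Ψ v) < η →
      ∃ u ∈ Metric.closedBall v (min r₀ r₂), Ψ u = x := by
    obtain ⟨W, hW, hWM⟩ := hΨ₀.image_eq
    have hvW : Ψ v ∈ W := by
      have : Ψ₀ v ∈ M ∩ W := hWM ▸ mem_image_of_mem Ψ₀ hv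
      rw [heq.eq_of_nhds]
      exact this.2
    have hnhds : (fun u : U => (u : Fin k → ℝ)) ⁻¹' Metric.closedBall v (min r₀ r₂) ∈
        𝓝 (⟨v, hv⟩ : U) :=
      continuous_subtype_val.continuousAt.preimage_mem_nhds
        (Metric.closedBall_mem_nhds _ (lt_min hr₀ hr₂))
    -- The topological embedding property excludes rational points of `M` near `Ψ v` whose
    -- parameters are far from `v`.
    rw [hΨ₀.isEmbedding.nhds_eq_comap, mem_comap] at hnhds
    obtain ⟨V, hV, hVsub⟩ := hnhds
    have hV' : V ∈ 𝓝 (Ψ v) := by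
      rw [heq.eq_of_nhds]
      exact hV
    obtain ⟨η, hη, hball⟩ := Metric.mem_nhds_iff.1 (inter_mem hV' (hW.mem_nhds hvW))
    refine ⟨η, hη, fun x hx hxη => ?_⟩
    have hxVW := hball hxη
    obtain ⟨u, hu, rfl⟩ : x ∈ Ψ₀ '' U := hWM ▸ ⟨hx, hxVW.2⟩
    have hub : u ∈ Metric.closedBall v (min r₀ r₂) :=
      hVsub (show (⟨u, hu⟩ : U) ∈ U.domRestrict Ψ₀ ⁻¹' V from hxVW.1)
    exact ⟨u, hub, (hr₂' (Metric.closedBall_subset_closedBall (min_le_right _ _) hub)).1⟩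
  obtain ⟨r₃, hr₃, hr₃'⟩ := Metric.nhds_basis_closedBall.eventually_iff.1
    (hΨ.continuous.continuousAt.eventually (Metric.ball_mem_nhds (Ψ v) (half_pos hη)))
  set r := min (min r₀ r₁) (min r₂ r₃) with hr
  have hr0 : 0 < r := lt_min (lt_min hr₀ hr₁) (lt_min hr₂ hr₃)
  have hrr₀ : r ≤ r₀ := (min_le_left _ _).trans (min_le_left _ _)
  have hrr₁ : r ≤ r₁ := (min_le_left _ _).trans (min_le_right _ _)
  have hrr₂ : r ≤ r₂ := (min_le_right _ _).trans (min_le_left _ _)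
  have hrr₃ : r ≤ r₃ := (min_le_right _ _).trans (min_le_right _ _)
  set N := Nkd k d with hNdef
  have hN : N ≠ 0 := by
    have := one_le_Nkd (k := k) hd
    omega
  have hdim : ∀ m : ℕ, 2 ≤ m →
      ENNReal.ofReal (Real.log m / (Real.log m + Real.log (4 / δ))) * k ≤
        dimH (BA M (psi (ckd k d))) := by
    intro m hm
    have hm0 : (0 : ℝ) < m := by positivity
    have hlm : 0 < Real.log m := Real.log_pos (by exact_mod_cast (by omega : 1 < m))
    have hlδ : 0 ≤ Real.log (4 / δ) := Real.log_nonneg (by rw [le_div_iff₀ hδ0]; linarith)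
    set t := Real.log m / (Real.log m + Real.log (4 / δ)) with ht
    have ht0 : 0 < t := by positivity
    obtain ⟨g, K, hK, hg1, hg2, hg3⟩ := exists_cantor_map (v := v) hr0 hδ0 hδ1
      (fun a ha ρ hρ0 hρ => hZ a (Metric.closedBall_subset_closedBall hrr₁ ha) ρ hρ0
        (hρ.trans hrr₁)) hm ht0 (rpow_log_div_log hδ0 hm0 (by positivity))
    set lam := δ / (4 * (m : ℝ)) with hlam
    have hlam0 : 0 < lam := by positivity
    have hlam1 : lam < 1 := by
      rw [hlam, div_lt_one (by positivity)]
      have : (2 : ℝ) ≤ m := by exact_mod_cast hm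
      linarith
    set B := univ.pi fun _ : Fin k => Ico (0 : ℝ) 1 with hB
    have hsub : (fun x => Ψ (g x)) '' B ⊆ BA M (psi (ckd k d)) := by
      rintro _ ⟨x, -, rfl⟩
      have hgx₂ := hr₂' (Metric.closedBall_subset_closedBall hrr₂ (hg1 x))
      have hgM : Ψ (g x) ∈ M := by
        obtain ⟨W, -, hWM⟩ := hΨ₀.image_eq
        have : Ψ₀ (g x) ∈ M ∩ W := hWM ▸ mem_image_of_mem Ψ₀ hgx₂.2
        rw [hgx₂.1]
        exact this.1
      -- The first constant serves rational points at distance at least `η` from `Ψ v`, where `psi ≤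
      -- 1` suffices; the second serves those lying in the chart.
      refine ⟨hgM, min (η / 2) (c₀ * (δ / 2 * min r (lam * C⁻¹ ^ (N : ℝ)⁻¹))), by positivity,
        fun p hp => ?_⟩
      have hH := one_le_height hp.1
      have hψ1 : psi (ckd k d) (height p) ≤ 1 := psi_le_one (ckd_nonneg k d) hH
      have hψ0 : 0 < psi (ckd k d) (height p) := psi_pos (by linarith)
      by_cases hpη : dist p (Ψ v) < η
      · obtain ⟨u, hu, rfl⟩ := hclose p hp.2 hpη
        have hexp' := hexp _ (Metric.closedBall_subset_closedBall hrr₀ (hg1 x)) u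
          (Metric.closedBall_subset_closedBall (min_le_left _ _) hu)
        refine le_trans ?_ hexp'
        have hex : ∃ n : ℕ, (height (Ψ u) : ℝ) ^ (d + 1) * (C * (r * lam ^ n) ^ N) < 1 := by
          have h1 : Tendsto (fun n : ℕ => (height (Ψ u) : ℝ) ^ (d + 1) * (C * (r * lam ^ n) ^ N))
              atTop (𝓝 ((height (Ψ u) : ℝ) ^ (d + 1) * (C * (r * 0) ^ N))) :=
            ((((tendsto_pow_atTop_nhds_zero_of_lt_one hlam0.le hlam1).const_mul r).pow N).const_mul
              C).const_mul _
          rw [mul_zero, zero_pow hN, mul_zero, mul_zero] at h1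
          exact (h1.eventually_lt_const one_pos).exists
        -- At the first scale excluding the point, either the scale is `r` itself and `psi ≤ 1`
        -- suffices, or the previous scale did not exclude it and is bounded below; one more step
        -- costs a factor `lam`.
        have hmain : min r (lam * C⁻¹ ^ (N : ℝ)⁻¹) * psi (ckd k d) (height (Ψ u)) ≤
            r * lam ^ Nat.find hex := by
          rcases hn : Nat.find hex with _ | n
          · rw [pow_zero, mul_one]
            calc _ ≤ r * 1 := by gcongr; exact min_le_left _ _
              _ = r := mul_one r
          · have hnot := Nat.find_min hex (m := n) (by omega)
            have h2 := le_of_one_le_pow_mul hN (by linarith) hC (by positivity) (not_lt.1 hnot)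
            calc _ ≤ lam * C⁻¹ ^ (N : ℝ)⁻¹ * psi (ckd k d) (height (Ψ u)) := by
                  gcongr; exact min_le_right _ _
              _ = lam * (C⁻¹ ^ (N : ℝ)⁻¹ * psi (ckd k d) (height (Ψ u))) := by ring
              _ ≤ lam * (r * lam ^ n) := mul_le_mul_of_nonneg_left h2 hlam0.le
              _ = r * lam ^ (n + 1) := by ring
        have h3 := hg2 x (Nat.find hex) u ⟨hp.1, Nat.find_spec hex⟩
        calc _ ≤ c₀ * (δ / 2 * min r (lam * C⁻¹ ^ (N : ℝ)⁻¹)) *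
              psi (ckd k d) (height (Ψ u)) := by gcongr; exact min_le_right _ _
          _ = c₀ * (δ / 2 * (min r (lam * C⁻¹ ^ (N : ℝ)⁻¹) *
              psi (ckd k d) (height (Ψ u)))) := by ring
          _ ≤ c₀ * (δ / 2 * (r * lam ^ Nat.find hex)) := by gcongr
          _ = c₀ * (δ * (r * lam ^ Nat.find hex) / 2) := by ring
          _ ≤ _ := by gcongr
      · have h1 : dist (Ψ (g x)) (Ψ v) < η / 2 :=
          hr₃' (Metric.closedBall_subset_closedBall hrr₃ (hg1 x))
        have h2 := dist_triangle p (Ψ (g x)) (Ψ v)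
        rw [dist_comm p (Ψ (g x))] at h2
        calc _ ≤ η / 2 * 1 := by gcongr; exact min_le_left _ _
          _ ≤ dist (Ψ (g x)) p := by linarith
    rw [← dimH_unitBox k]
    refine (mul_dimH_le_dimH_image (K := K * c₀⁻¹ ^ t) ht0 fun x hx y hy => ?_).trans
      (dimH_mono hsub)
    refine (hg3 x hx y hy).trans ?_
    rw [mul_assoc, ← Real.mul_rpow (by positivity) dist_nonneg]
    gcongr
    rw [le_inv_mul_iff₀ hc₀]
    exact hexp _ (Metric.closedBall_subset_closedBall hrr₀ (hg1 x)) _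
      (Metric.closedBall_subset_closedBall hrr₀ (hg1 y))
  have hlim : Tendsto (fun m : ℕ =>
      ENNReal.ofReal (Real.log m / (Real.log m + Real.log (4 / δ))) * (k : ℝ≥0∞)) atTop
      (𝓝 (ENNReal.ofReal 1 * k)) :=
    ENNReal.Tendsto.mul_const (ENNReal.tendsto_ofReal (tendsto_log_div_log _)) (Or.inl (by simp))
  rw [ENNReal.ofReal_one, one_mul] at hlim
  exact le_of_tendsto hlim ((eventually_ge_atTop 2).mono hdim)

/-- Hausdorff dimension is detected locally, and a smooth chart is locally Lipschitz, so it cannot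
raise the dimension `k` of the parameter space. -/
theorem dimH_submanifold_le {k d : ℕ} {M : Set (Fin d → ℝ)} (hM : IsSubmanifold k M) :
    dimH M ≤ k := by
  by_contra! h
  obtain ⟨x, hx, hdim⟩ := exists_mem_nhdsWithin_lt_dimH_of_lt_dimH h
  obtain ⟨U, Ψ, hΨ, u, hu, rfl⟩ := hM x hx
  obtain ⟨W, hW, hWM⟩ := hΨ.image_eq
  have hmem : Ψ '' U ∈ 𝓝[M] (Ψ u) := by
    have : Ψ u ∈ M ∩ W := hWM ▸ mem_image_of_mem Ψ hu
    rw [hWM]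
    exact inter_mem self_mem_nhdsWithin (mem_nhdsWithin_of_mem_nhds (hW.mem_nhds this.2))
  refine (hdim _ hmem).not_ge ?_
  calc dimH (Ψ '' U) ≤ dimH U := dimH_image_le_of_locally_lipschitzOn fun y hy => by
        have hc : ContDiffAt ℝ 1 Ψ y :=
          (hΨ.contDiffOn.contDiffAt (hΨ.isOpen.mem_nhds hy)).of_le (by exact_mod_cast le_top)
        obtain ⟨K, t, ht, hK⟩ := hc.exists_lipschitzOnWith
        exact ⟨K, t, mem_nhdsWithin_of_mem_nhds ht, hK⟩
    _ ≤ dimH (univ : Set (Fin k → ℝ)) := dimH_mono (subset_univ _)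
    _ = k := Real.dimH_univ_pi_fin k

/-! ### Optimality of Dirichlet functions -/

/-- If there are `ψ_c`-badly approximable points, then no Dirichlet function decays faster than
`ψ_c`. -/
theorem not_tendsto_of_mem_BA {d : ℕ} {M : Set (Fin d → ℝ)} {c : ℝ} (hc : 0 ≤ c)
    {x : Fin d → ℝ} (hx : x ∈ BA M (psi c)) {φ : ℝ → ℝ} (hφ : IsIntrinsicDirichlet M φ) :
    ¬ Tendsto (fun t => φ t / psi c t) atTop (𝓝 0) := by
  intro hlim
  obtain ⟨hxM, ε, hε, hBA⟩ := hx
  obtain ⟨C, r, hrQ, hrx, hr⟩ := hφ.2 x hxM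
  have hH : ∀ n, (1 : ℝ) ≤ height (r n) := fun n => one_le_height (hrQ n).1
  have hdist : Tendsto (fun n => dist x (r n)) atTop (𝓝 0) := by
    simpa using (tendsto_const_nhds (x := x)).dist hrx
  -- The approximants need not be distinct, but bad approximability keeps those of bounded height at
  -- a positive distance from `x`.
  have htop : Tendsto (fun n => (height (r n) : ℝ)) atTop atTop := by
    refine tendsto_atTop.2 fun b => ?_
    have hb : 0 < ε * psi c (max b 1) := mul_pos hε (psi_pos (by positivity))
    filter_upwards [hdist.eventually_lt_const hb] with n hn
    by_contra! hlt
    have h1 : psi c (max b 1) ≤ psi c (height (r n)) := by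
      have h0 : (0 : ℝ) < height (r n) := by linarith [hH n]
      unfold psi
      gcongr
      exact hlt.le.trans (le_max_left _ _)
    have h2 := hBA (r n) (hrQ n)
    have h3 := mul_le_mul_of_nonneg_left h1 hε.le
    linarith
  have h1 : Tendsto (fun n => C * (φ (height (r n)) / psi c (height (r n)))) atTop (𝓝 (C * 0)) :=
    (hlim.comp htop).const_mul C
  rw [mul_zero] at h1
  refine (ge_of_tendsto' h1 fun n => ?_).not_gt hε
  have hψ : 0 < psi c (height (r n)) := psi_pos (by linarith [hH n])
  rw [← mul_div_assoc, le_div_iff₀ hψ]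
  exact (hBA (r n) (hrQ n)).trans (hr n)

theorem tendsto_psi_div_psi {c c' : ℝ} (h : c < c') :
    Tendsto (fun t => psi c' t / psi c t) atTop (𝓝 0) := by
  refine (tendsto_rpow_neg_atTop (sub_pos.2 h)).congr' ?_
  filter_upwards [eventually_gt_atTop 0] with t ht
  rw [psi, psi, neg_sub, Real.rpow_sub ht]
  field_simp

end IntrinsicApprox

theorem theorem1p3 (k d : ℕ) (hk : 1 ≤ k) (M : Set (Fin d → ℝ))
    (hM : IsNondegenerateSubmanifold k M) :
    dimH (BA M (psi (ckd k d))) = (k : ℝ≥0∞) ∧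
    (¬ ∃ φ : ℝ → ℝ, IsIntrinsicDirichlet M φ ∧
      Tendsto (fun t => φ t / psi (ckd k d) t) atTop (𝓝 0)) ∧
    intrinsicDirichletExponent M ≤ ENNReal.ofReal (ckd k d) := by
  obtain ⟨hsub, x, hx, D, -, U, Ψ, hΨ, v, hv, -, hosc⟩ := hM
  -- An injective linear map from `ℝ^k` with `k ≥ 1` cannot land in `ℝ^0`.
  have hd : 1 ≤ d := by
    rw [Nat.one_le_iff_ne_zero]
    rintro rfl
    have h1 := hΨ.immersion v hv
      (Subsingleton.elim (fderiv ℝ Ψ v fun _ => 1) (fderiv ℝ Ψ v fun _ => 0))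
    exact one_ne_zero (congrFun h1 (⟨0, hk⟩ : Fin k))
  have hdim : dimH (BA M (psi (ckd k d))) = (k : ℝ≥0∞) :=
    le_antisymm ((dimH_mono fun _ hy => hy.1).trans (dimH_submanifold_le hsub))
      (le_dimH_BA hk hd hΨ hv hosc)
  obtain ⟨y, hy⟩ : (BA M (psi (ckd k d))).Nonempty := by
    rw [nonempty_iff_ne_empty]
    intro h
    rw [h, dimH_empty] at hdim
    have : k = 0 := by exact_mod_cast hdim.symm
    omega
  refine ⟨hdim, fun ⟨φ, hφ, hlim⟩ => not_tendsto_of_mem_BA (ckd_nonneg k d) hy hφ hlim,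
    sSup_le ?_⟩
  rintro _ ⟨c, -, hc, rfl⟩
  refine ENNReal.ofReal_le_ofReal (not_lt.1 fun hlt => ?_)
  exact not_tendsto_of_mem_BA (ckd_nonneg k d) hy hc (tendsto_psi_div_psi hlt)
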